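/- All matroids have a finite ground set; $U_{k,n}$ is the uniform matroid of rank $k$ on $n$ elements. For a matroid $M$ and a flat $F$, let $M^F$ be the restriction of $M$ to $F$ and $M_F$ the contraction of $M$ by $F$, and let $\chi_M(t)=\sum_{A\subseteq E}(-1)^{|A|}t^{\operatorname{rk}M-\operatorname{rk}A}$ be the characteristic polynomial of a matroid $M$ with ground set $E$. The Kazhdan–Lusztig polynomial $P_M(t)\in\mathbb Z[t]$ and the inverse Kazhdan–Lusztig polynomial $Q_M(t)\in\mathbb Z[t]$ are the unique assignments such that: (i) if $\operatorname{rk}M=0$, then $P_M=Q_M=1$ when $E=\varnothing$, and $P_M=Q_M=0$ otherwise; (ii) if $\operatorname{rk}M>0$, then $\deg P_M,\deg Q_M<\tfrac12\operatorname{rk}M$; (iii) for every $M$, with sums over all flats $F$ of $M$, $$t^{\operatorname{rk}M}P_M(t^{-1})=\sum_F\chi_{M^F}(t)\,P_{M_F}(t),\qquad (-t)^{\operatorname{rk}M}Q_M(t^{-1})=\sum_F(-1)^{\operatorname{rk}F}Q_{M^F}(t)\,t^{\operatorname{rk}M-\operatorname{rk}F}\chi_{M_F}(t^{-1}).$$ The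 $Z$-polynomial is $Z_M(t)=\sum_F t^{\operatorname{rk}F}P_{M_F}(t)$. A hyperplane $H$ (a flat of rank $\operatorname{rk}M-1$) of a matroid $M$ of rank $k$ is stressed if all subsets of $H$ of cardinality $k$ are circuits. Its relaxation $\widetilde M$ is then the matroid on the same ground set whose bases are those of $M$ together with all $k$-element subsets of $H$. A matroid of rank $k$ is paving if all its circuits have at least $k$ elements. **Theorem.** There are polynomials $p_{k,h}(t),q_{k,h}(t),z_{k,h}(t)\in\mathbb Z[t]$, depending only on $k$ and $h$, with the following two properties. (a) For all integers $k,h\ge1$ and every matroid $M$ of rank $k$ with a stressed hyperplane $H$ of cardinality $h$, the relaxation $\widetilde M$ of $H$ satisfies $$P_{\widetilde M}=P_M+p_{k,h},\qquad Q_{\widetilde M}=Q_M+q_{k,h},\qquad Z_{\widetilde M}=Z_M+z_{k,h}.$$ (b) For every paving matroid $M$ of rank $k$ on $n$ elements with exactly $\lambda_h$ hyperplanes of cardinality $h$ (for each $h$), $$P_M=P_{U_{k,n}}-\sum_{h\ge k}\lambda_h\,p_{k,h},\qquad Q_M=Q_{U_{k,n}}-\sum_{h\ge k}\lambda_h\,q_{k,h},\qquad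 Z_M=Z_{U_{k,n}}-\sum_{h\ge k}\lambda_h\,z_{k,h}.$$ -/

import Mathlib

open scoped Polynomial

universe u

namespace Matroid

/-- The rank of `M` as a natural number (meaningful for finite matroids). -/
noncomputable def natRank {α : Type u} (M : Matroid α) : ℕ := M.eRank.toNat

/-- The rank of the set `A` in `M` as a natural number (meaningful for finite matroids). -/
noncomputable def natRk {α : Type u} (M : Matroid α) (A : Set α) : ℕ := (M.eRk A).toNat

/-- A hyperplane is a flat of rank `rk M - 1`. In a matroid of rank `0` there is none. -/
def IsHyperplane {α : Type u} (M : Matroid α) (H : Set α) : Prop :=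
  M.IsFlat H ∧ M.eRk H + 1 = M.eRank

/-- A hyperplane is stressed if all its subsets of cardinality `rk M` are circuits. -/
def IsStressedHyperplane {α : Type u} (M : Matroid α) (H : Set α) : Prop :=
  M.IsHyperplane H ∧ ∀ S ⊆ H, S.encard = M.eRank → M.IsCircuit S

/-- A matroid is paving if all its circuits have at least `rk M` elements. -/
def IsPaving {α : Type u} (M : Matroid α) : Prop :=
  ∀ C, M.IsCircuit C → M.eRank ≤ C.encard

/-- The number of hyperplanes of cardinality `h`. -/
noncomputable def numHyperplanes {α : Type u} (M : Matroid α) (h : ℕ) : ℕ :=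
  {H : Set α | M.IsHyperplane H ∧ H.ncard = h}.ncard

/-- The uniform matroid `U_{k,n}`: the independent sets are the subsets of the `n`-element ground
set with at most `k` elements. For `k ≤ n` its bases are exactly the `k`-subsets. -/
def uniform (k n : ℕ) : Matroid (Fin n) :=
  (IndepMatroid.ofFinite (E := Set.univ) Set.finite_univ (fun I => I.ncard ≤ k)
    (by simp)
    (fun I J hJ hIJ => (Set.ncard_le_ncard hIJ (Set.toFinite J)).trans hJ)
    (by
      intro I J hI hJ hlt
      obtain ⟨e, heJ, heI⟩ := Set.exists_mem_notMem_of_ncard_lt_ncard hlt (Set.toFinite I)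
      refine ⟨e, heJ, heI, ?_⟩
      rw [Set.ncard_insert_of_notMem heI (Set.toFinite I)]
      omega)
    (fun I _ => Set.subset_univ I)).matroid

theorem uniform_indep_iff (k n : ℕ) (I : Set (Fin n)) :
    (uniform k n).Indep I ↔ I.ncard ≤ k := Iff.rfl

theorem uniform_isBase_iff {k n : ℕ} (hkn : k ≤ n) (B : Set (Fin n)) :
    (uniform k n).IsBase B ↔ B.ncard = k := by
  rw [isBase_iff_maximal_indep]
  constructor
  · intro h
    have h1 : B.ncard ≤ k := h.prop
    by_contra hne
    have hlt : B.ncard < (Set.univ : Set (Fin n)).ncard := by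
      rw [Set.ncard_univ, Nat.card_fin]; omega
    obtain ⟨e, -, he⟩ := Set.exists_mem_notMem_of_ncard_lt_ncard hlt (Set.toFinite B)
    have hi : (uniform k n).Indep (insert e B) := by
      rw [uniform_indep_iff, Set.ncard_insert_of_notMem he (Set.toFinite B)]
      omega
    exact he (h.le_of_ge hi (Set.subset_insert e B) (Set.mem_insert e B))
  · intro h
    refine ⟨h.le, fun J hJ hBJ => ?_⟩
    have hJ' : J.ncard ≤ k := hJ
    exact (Set.eq_of_subset_of_ncard_le hBJ (by omega) (Set.toFinite J)).symm.subset

theorem relax_exchange {α : Type u} {M : Matroid α} [M.Finite] {H : Set α}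
    (hH : M.IsStressedHyperplane H) :
    ExchangeProperty (fun B => M.IsBase B ∨ (B ⊆ H ∧ B.encard = M.eRank)) := by
  obtain ⟨⟨hflat, hrk⟩, hstr⟩ := hH
  have hHE : H ⊆ M.E := hflat.subset_ground
  have hHfin : H.Finite := M.ground_finite.subset hHE
  intro B₁ B₂ h₁ h₂ a ha
  have hB₁fin : B₁.Finite := by
    rcases h₁ with h | h
    · exact h.finite
    · exact hHfin.subset h.1
  have hB₂fin : B₂.Finite := by
    rcases h₂ with h | h
    · exact h.finite
    · exact hHfin.subset h.1
  have hc₁ : B₁.encard = M.eRank := by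
    rcases h₁ with h | h
    · exact h.encard_eq_eRank
    · exact h.2
  have hc₂ : B₂.encard = M.eRank := by
    rcases h₂ with h | h
    · exact h.encard_eq_eRank
    · exact h.2
  have hcard : ∀ b, b ∉ B₁ → (insert b (B₁ \ {a})).encard = M.eRank := by
    intro b hb
    rw [Set.encard_insert_of_notMem (fun hb' => hb hb'.1),
      Set.encard_sdiff_singleton_add_one ha.1, hc₁]
  have hind : M.Indep (B₁ \ {a}) := by
    rcases h₁ with h | h
    · exact h.indep.subset Set.sdiff_subset
    · exact (hstr _ h.1 h.2).sdiff_singleton_indep ha.1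
  have hbase : ∀ b, b ∉ B₁ → M.Indep (insert b (B₁ \ {a})) →
      M.IsBase (insert b (B₁ \ {a})) := by
    intro b hb hi
    refine hi.isBase_of_eRk_ge ((hB₁fin.sdiff).insert b) ?_
    rw [hi.eRk_eq_encard, hcard b hb]
  by_cases hB₂ : M.IsBase B₂
  · -- the second set is an old basis: augment
    have hnb : ¬ M.IsBase (B₁ \ {a}) := by
      intro hb
      have h3 := hb.encard_eq_eRank
      have h4 := Set.encard_sdiff_singleton_add_one ha.1
      rw [h3, hc₁] at h4
      have h5 : M.eRank ≠ ⊤ := by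
        rw [← hc₁]; exact hB₁fin.encard_lt_top.ne
      have := (ENat.add_one_le_iff h5).1 h4.le
      exact lt_irrefl _ this
    obtain ⟨e, he, hei⟩ := hind.exists_insert_of_not_isBase hnb hB₂
    have heB₁ : e ∉ B₁ := by
      intro h
      exact he.2 ⟨h, fun h' => ha.2 (h' ▸ he.1)⟩
    exact ⟨e, ⟨he.1, heB₁⟩, Or.inl (hbase e heB₁ hei)⟩
  · have hB₂H : B₂ ⊆ H := (h₂.resolve_left hB₂).1
    by_cases hsub : B₁ \ {a} ⊆ H
    · -- everything takes place inside `H`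
      have hns : ¬ B₂ ⊆ B₁ := by
        intro h
        have := hB₁fin.eq_of_subset_of_encard_le' h (by rw [hc₁, hc₂])
        exact ha.2 (this ▸ ha.1)
      obtain ⟨b, hb₂, hb₁⟩ := Set.not_subset.1 hns
      exact ⟨b, ⟨hb₂, hb₁⟩, Or.inr ⟨Set.insert_subset (hB₂H hb₂) hsub, hcard b hb₁⟩⟩
    · by_contra hno
      push Not at hno
      have hcl : B₂ ⊆ M.closure (B₁ \ {a}) := by
        intro b hb
        by_cases hb₁ : b ∈ B₁
        · exact M.mem_closure_of_mem' ⟨hb₁, fun h => ha.2 (h ▸ hb)⟩ (hHE (hB₂H hb))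
        · by_contra hbn
          have hi : M.Indep (insert b (B₁ \ {a})) :=
            (hind.notMem_closure_iff_of_notMem (fun h => hb₁ h.1)
              (hHE (hB₂H hb))).1 hbn
          exact (hno b ⟨hb, hb₁⟩).1 (hbase b hb₁ hi)
      have hcirc : M.IsCircuit B₂ := hstr B₂ hB₂H hc₂
      have e1 : M.eRk B₂ + 1 = M.eRk H + 1 := by rw [hcirc.eRk_add_one_eq, hc₂, hrk]
      have e2 : M.eRk (B₁ \ {a}) + 1 = M.eRk H + 1 := by
        rw [hind.eRk_eq_encard, Set.encard_sdiff_singleton_add_one ha.1, hc₁, hrk]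
      have e1' : M.eRk B₂ = M.eRk H := WithTop.add_right_cancel ENat.one_ne_top e1
      have e2' : M.eRk (B₁ \ {a}) = M.eRk H := WithTop.add_right_cancel ENat.one_ne_top e2
      have c1 : M.closure B₂ = M.closure H :=
        (M.isRkFinite_of_finite hB₂fin).closure_eq_closure_of_subset_of_eRk_ge_eRk hB₂H e1'.ge
      have c2 : M.closure B₂ = M.closure (M.closure (B₁ \ {a})) :=
        (M.isRkFinite_of_finite hB₂fin).closure_eq_closure_of_subset_of_eRk_ge_eRk hcl
          (by rw [eRk_closure_eq, e1', e2'])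
      rw [closure_closure, c1, hflat.closure] at c2
      apply hsub
      rw [c2]
      exact M.subset_closure _ hind.subset_ground

/-- The relaxation of a stressed hyperplane `H`: the bases are those of `M` together with
all subsets of `H` of cardinality `rk M`. -/
def relax {α : Type u} (M : Matroid α) [M.Finite] {H : Set α} (hH : M.IsStressedHyperplane H) :
    Matroid α :=
  Matroid.ofIsBaseOfFinite M.ground_finite
    (fun B => M.IsBase B ∨ (B ⊆ H ∧ B.encard = M.eRank))
    (by obtain ⟨B, hB⟩ := M.exists_isBase; exact ⟨B, Or.inl hB⟩)
    (relax_exchange hH)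
    (fun B hB => hB.elim (fun h => h.subset_ground)
      (fun h => h.1.trans hH.1.1.subset_ground))

/-- The characteristic polynomial
`χ_M(t) = (-1)^{rk M} T_M(1 - t, 0) = ∑_{A ⊆ E} (-1)^{|A|} t^{rk M - rk A}`
(equal to `0` if `M` has loops, and to the characteristic polynomial of the lattice of flats
otherwise). -/
noncomputable def charPoly {α : Type u} (M : Matroid α) : ℤ[X] :=
  ∑ᶠ A : {A : Set α // A ⊆ M.E},
    (-1) ^ (A : Set α).ncard * Polynomial.X ^ (M.natRank - M.natRk A)

/-- The part of `R` consisting of the terms of degree `i < k / 2`. -/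
noncomputable def lowHalf (k : ℕ) (R : ℤ[X]) : ℤ[X] :=
  ∑ i ∈ (Finset.range k).filter (fun i => 2 * i < k), Polynomial.monomial i (R.coeff i)

theorem coeff_lowHalf (k : ℕ) (R : ℤ[X]) (i : ℕ) :
    (lowHalf k R).coeff i = if 2 * i < k then R.coeff i else 0 := by
  simp only [lowHalf, Polynomial.finsetSum_coeff, Polynomial.coeff_monomial,
    Finset.sum_ite_eq', Finset.mem_filter, Finset.mem_range]
  by_cases h : 2 * i < k
  · rw [if_pos ⟨by omega, h⟩, if_pos h]
  · rw [if_neg (fun h' => h h'.2), if_neg h]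

open Classical in
/-- The Kazhdan--Lusztig polynomial `P_M`. It is the assignment determined by
* if `rk M = 0`, then `P_M = 1` for the empty ground set and `P_M = 0` otherwise;
* if `rk M > 0`, then `deg P_M < rk M / 2`;
* `t^{rk M} P_M(t⁻¹) = ∑_F χ_{M^F}(t) P_{M_F}(t)`, the sum running over all flats `F`.

The summand of `F = ∅` (if `∅` is a flat) is `P_M` itself, so the third condition says that the
sum over `F ≠ ∅` is `t^{rk M} P_M(t⁻¹) - P_M(t)`; its part of degree `< rk M / 2` is `-P_M`.
Here `M^F = M ↾ F` is the localization and `M_F = M ／ F` the contraction. -/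
noncomputable def klPoly {α : Type u} (M : Matroid α) : ℤ[X] :=
  if hM : M.Finite then
    if M.natRank = 0 then (if M.E = ∅ then 1 else 0)
    else - lowHalf M.natRank
      (∑ᶠ F : {F : Set α // M.IsFlat F ∧ F ≠ ∅},
        charPoly (M ↾ (F : Set α)) * klPoly (M ／ (F : Set α)))
  else 0
termination_by M.E.ncard
decreasing_by
  rw [contract_ground]
  refine Set.ncard_lt_ncard ?_ hM.ground_finite
  obtain ⟨x, hx⟩ := Set.nonempty_iff_ne_empty.2 F.2.2
  exact (Set.ssubset_iff_of_subset Set.sdiff_subset).2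
    ⟨x, F.2.1.subset_ground hx, fun h => h.2 hx⟩

open Classical in
/-- The inverse Kazhdan--Lusztig polynomial `Q_M`. It is the assignment determined by
* if `rk M = 0`, then `Q_M = 1` for the empty ground set and `Q_M = 0` otherwise;
* if `rk M > 0`, then `deg Q_M < rk M / 2`;
* `(-t)^{rk M} Q_M(t⁻¹) = ∑_F (-1)^{rk F} Q_{M^F}(t) t^{rk M - rk F} χ_{M_F}(t⁻¹)`,
  the sum running over all flats `F`.

The summand of `F = E` is `(-1)^{rk M} Q_M`, so the third condition says that the sum over
`F ≠ E` is `(-1)^{rk M} (t^{rk M} Q_M(t⁻¹) - Q_M(t))`.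
Here `Polynomial.reflect d p` is `t^d p(t⁻¹)` for `deg p ≤ d`. -/
noncomputable def invKLPoly {α : Type u} (M : Matroid α) : ℤ[X] :=
  if hM : M.Finite then
    if M.natRank = 0 then (if M.E = ∅ then 1 else 0)
    else - (-1) ^ M.natRank * lowHalf M.natRank
      (∑ᶠ F : {F : Set α // M.IsFlat F ∧ F ≠ M.E},
        (-1) ^ M.natRk F * invKLPoly (M ↾ (F : Set α)) *
          Polynomial.reflect (M.natRank - M.natRk F) (charPoly (M ／ (F : Set α))))
  else 0
termination_by M.E.ncard
decreasing_by
  rw [restrict_ground_eq]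
  exact Set.ncard_lt_ncard (F.2.1.subset_ground.ssubset_of_ne F.2.2) hM.ground_finite

/-- The `Z`-polynomial `Z_M(t) = ∑_F t^{rk F} P_{M_F}(t)`, the sum running over all flats. -/
noncomputable def zPoly {α : Type u} (M : Matroid α) : ℤ[X] :=
  ∑ᶠ F : {F : Set α // M.IsFlat F},
    Polynomial.X ^ M.natRk F * klPoly (M ／ (F : Set α))

/-! The remaining lemmas check that `klPoly` and `invKLPoly` are the only candidates for
assignments with the three defining properties. -/

theorem charPoly_eq_zero_of_isLoop {α : Type u} (M : Matroid α) [M.Finite] {e : α}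
    (he : M.IsLoop e) : charPoly M = 0 := by
  classical
  have heE : e ∈ M.E := he.mem_ground
  let g : {A : Set α // A ⊆ M.E} → {A : Set α // A ⊆ M.E} := fun A =>
    if e ∈ (A : Set α) then ⟨(A : Set α) \ {e}, Set.sdiff_subset.trans A.2⟩
    else ⟨insert e (A : Set α), Set.insert_subset heE A.2⟩
  have hg : Function.Involutive g := by
    rintro ⟨A, hA⟩
    by_cases h : e ∈ A
    · simp [g, h, Set.insert_eq_of_mem]
    · simp [g, h]
  have hrk : ∀ A : Set α, M.natRk (insert e A) = M.natRk A := by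
    intro A
    have h0 : M.eRk {e} ≤ 0 := he.eRk_eq.le
    rw [natRk, natRk, ← Set.union_singleton, eRk_eq_eRk_union_eRk_le_zero A h0]
  have hsign : ∀ A : {A : Set α // A ⊆ M.E},
      (-1 : ℤ[X]) ^ (g A : Set α).ncard * Polynomial.X ^ (M.natRank - M.natRk (g A))
        = -((-1) ^ (A : Set α).ncard * Polynomial.X ^ (M.natRank - M.natRk A)) := by
    rintro ⟨A, hA⟩
    have hAf : A.Finite := M.ground_finite.subset hA
    by_cases h : e ∈ A
    · have h1 : (A \ {e}).ncard + 1 = A.ncard := Set.ncard_sdiff_singleton_add_one h hAf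
      have h2 : M.natRk (A \ {e}) = M.natRk A := by
        rw [← hrk (A \ {e}), Set.insert_sdiff_singleton, Set.insert_eq_of_mem h]
      simp only [g, h, if_true, h2, ← h1, pow_succ]
      ring
    · simp only [g, h, if_false, hrk, Set.ncard_insert_of_notMem h hAf, pow_succ]
      ring
  have hsum : charPoly M = - charPoly M := by
    unfold charPoly
    rw [← finsum_neg_distrib, ← finsum_comp_equiv hg.toPerm]
    exact finsum_congr hsign
  exact self_eq_neg.1 hsum

theorem charPoly_eq_one {α : Type u} (M : Matroid α) (hE : M.E = ∅) : charPoly M = 1 := by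
  have : Unique {A : Set α // A ⊆ M.E} :=
    ⟨⟨⟨∅, Set.empty_subset _⟩⟩, fun A => Subtype.ext (Set.subset_empty_iff.1 (hE ▸ A.2))⟩
  have h0 : M.natRank = 0 := by
    rw [natRank, eRank_def, hE, eRk_empty]; rfl
  have hd : ((default : {A : Set α // A ⊆ M.E}) : Set α) = ∅ :=
    Set.subset_empty_iff.1 (hE ▸ (default : {A : Set α // A ⊆ M.E}).2)
  rw [charPoly, finsum_unique, hd, h0]
  simp

/-- Splitting off one flat from a sum over all flats. -/
theorem finsum_flats_split {α : Type u} (M : Matroid α) [M.Finite] (G : Set α) (hG : M.IsFlat G)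
    (f : Set α → ℤ[X]) :
    ∑ᶠ F : {F : Set α // M.IsFlat F}, f F
      = f G + ∑ᶠ F : {F : Set α // M.IsFlat F ∧ F ≠ G}, f F := by
  have hfin : {F : Set α | M.IsFlat F ∧ F ≠ G}.Finite :=
    M.ground_finite.finite_subsets.subset fun F hF => hF.1.subset_ground
  have h1 : ∑ᶠ F : {F : Set α // M.IsFlat F}, f F = ∑ᶠ F ∈ {F : Set α | M.IsFlat F}, f F :=
    finsum_set_coe_eq_finsum_mem {F : Set α | M.IsFlat F}
  have h2 : ∑ᶠ F : {F : Set α // M.IsFlat F ∧ F ≠ G}, f F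
      = ∑ᶠ F ∈ {F : Set α | M.IsFlat F ∧ F ≠ G}, f F :=
    finsum_set_coe_eq_finsum_mem {F : Set α | M.IsFlat F ∧ F ≠ G}
  have h3 : {F : Set α | M.IsFlat F} = insert G {F : Set α | M.IsFlat F ∧ F ≠ G} := by
    ext F
    by_cases h : F = G
    · simp [h, hG]
    · simp [h]
  rw [h1, h2, h3, finsum_mem_insert f (by simp) hfin]

theorem lowHalf_reflect {k : ℕ} {P : ℤ[X]} (hP : 2 * P.natDegree < k) :
    lowHalf k (Polynomial.reflect k P) = 0 ∧ lowHalf k P = P := by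
  constructor
  · ext i
    rw [coeff_lowHalf]
    split_ifs with h
    · rw [Polynomial.coeff_reflect, Polynomial.revAt_le (by omega),
        Polynomial.coeff_eq_zero_of_natDegree_lt (by omega), Polynomial.coeff_zero]
    · simp
  · ext i
    rw [coeff_lowHalf]
    split_ifs with h
    · rfl
    · rw [Polynomial.coeff_eq_zero_of_natDegree_lt (by omega)]

theorem lowHalf_add (k : ℕ) (R S : ℤ[X]) : lowHalf k (R + S) = lowHalf k R + lowHalf k S := by
  ext i
  simp only [coeff_lowHalf, Polynomial.coeff_add]
  split_ifs <;> simp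

theorem klPoly_unique {α : Type u} (P : Matroid α → ℤ[X])
    (h0 : ∀ M : Matroid α, M.Finite → M.natRank = 0 →
      (M.E = ∅ → P M = 1) ∧ (M.E ≠ ∅ → P M = 0))
    (hdeg : ∀ M : Matroid α, M.Finite → 0 < M.natRank → 2 * (P M).natDegree < M.natRank)
    (hrec : ∀ M : Matroid α, M.Finite → Polynomial.reflect M.natRank (P M) =
      ∑ᶠ F : {F : Set α // M.IsFlat F}, charPoly (M ↾ (F : Set α)) * P (M ／ (F : Set α)))
    (M : Matroid α) (hM : M.Finite) : P M = klPoly M := by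
  induction hn : M.E.ncard using Nat.strong_induction_on generalizing M with
  | _ n ih =>
    subst hn
    rw [klPoly, dif_pos hM]
    by_cases hr : M.natRank = 0
    · rw [if_pos hr]
      split_ifs with hE
      · exact (h0 M hM hr).1 hE
      · exact (h0 M hM hr).2 hE
    · rw [if_neg hr]
      have hd := hdeg M hM (Nat.pos_of_ne_zero hr)
      have key : ∑ᶠ F : {F : Set α // M.IsFlat F ∧ F ≠ ∅},
            charPoly (M ↾ (F : Set α)) * klPoly (M ／ (F : Set α))
          = ∑ᶠ F : {F : Set α // M.IsFlat F ∧ F ≠ ∅},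
            charPoly (M ↾ (F : Set α)) * P (M ／ (F : Set α)) := by
        refine finsum_congr fun F => ?_
        rw [ih _ ?_ (M ／ (F : Set α)) inferInstance rfl]
        rw [contract_ground]
        refine Set.ncard_lt_ncard ?_ hM.ground_finite
        obtain ⟨x, hx⟩ := Set.nonempty_iff_ne_empty.2 F.2.2
        exact (Set.ssubset_iff_of_subset Set.sdiff_subset).2
          ⟨x, F.2.1.subset_ground hx, fun h => h.2 hx⟩
      rw [key]
      have hrecM := hrec M hM
      by_cases hfl : M.IsFlat ∅
      · rw [finsum_flats_split M ∅ hfl (fun F => charPoly (M ↾ F) * P (M ／ F)),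
          charPoly_eq_one _ (restrict_ground_eq), one_mul, contract_empty] at hrecM
        have h := congrArg (lowHalf M.natRank) hrecM
        rw [lowHalf_add, (lowHalf_reflect hd).1, (lowHalf_reflect hd).2] at h
        exact eq_neg_of_add_eq_zero_left h.symm
      · have hloop : ∃ e, M.IsLoop e := by
          by_contra hno
          push Not at hno
          refine hfl (isFlat_iff_closure_eq.2 ?_)
          exact Set.eq_empty_iff_forall_notMem.2 hno
        obtain ⟨e, he⟩ := hloop
        have hz : ∀ F : Set α, M.IsFlat F → charPoly (M ↾ F) = 0 := by
          intro F hF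
          have := restrict_finite (M := M) (hM.ground_finite.subset hF.subset_ground)
          refine charPoly_eq_zero_of_isLoop (M ↾ F) (e := e) ?_
          have heF : e ∈ F := he.mem_of_isFlat hF
          rw [← singleton_dep, restrict_dep_iff]
          exact ⟨(singleton_dep.2 he).not_indep, Set.singleton_subset_iff.2 heF⟩ 
        have e1 : ∑ᶠ F : {F : Set α // M.IsFlat F ∧ F ≠ ∅},
            charPoly (M ↾ (F : Set α)) * P (M ／ (F : Set α)) = 0 :=
          finsum_eq_zero_of_forall_eq_zero fun F => by rw [hz F F.2.1, zero_mul]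
        have e2 : ∑ᶠ F : {F : Set α // M.IsFlat F},
            charPoly (M ↾ (F : Set α)) * P (M ／ (F : Set α)) = 0 :=
          finsum_eq_zero_of_forall_eq_zero fun F => by rw [hz F F.2, zero_mul]
        rw [e2, Polynomial.reflect_eq_zero_iff] at hrecM
        rw [e1, hrecM]
        ext i
        simp [coeff_lowHalf]

theorem invKLPoly_unique {α : Type u} (Q : Matroid α → ℤ[X])
    (h0 : ∀ M : Matroid α, M.Finite → M.natRank = 0 →
      (M.E = ∅ → Q M = 1) ∧ (M.E ≠ ∅ → Q M = 0))
    (hdeg : ∀ M : Matroid α, M.Finite → 0 < M.natRank → 2 * (Q M).natDegree < M.natRank)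
    (hrec : ∀ M : Matroid α, M.Finite → (-1) ^ M.natRank * Polynomial.reflect M.natRank (Q M) =
      ∑ᶠ F : {F : Set α // M.IsFlat F}, (-1) ^ M.natRk F * Q (M ↾ (F : Set α)) *
        Polynomial.reflect (M.natRank - M.natRk F) (charPoly (M ／ (F : Set α))))
    (M : Matroid α) (hM : M.Finite) : Q M = invKLPoly M := by
  induction hn : M.E.ncard using Nat.strong_induction_on generalizing M with
  | _ n ih =>
    subst hn
    rw [invKLPoly, dif_pos hM]
    by_cases hr : M.natRank = 0
    · rw [if_pos hr]
      split_ifs with hE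
      · exact (h0 M hM hr).1 hE
      · exact (h0 M hM hr).2 hE
    · rw [if_neg hr]
      have hd := hdeg M hM (Nat.pos_of_ne_zero hr)
      have key : ∑ᶠ F : {F : Set α // M.IsFlat F ∧ F ≠ M.E},
            (-1) ^ M.natRk F * invKLPoly (M ↾ (F : Set α)) *
              Polynomial.reflect (M.natRank - M.natRk F) (charPoly (M ／ (F : Set α)))
          = ∑ᶠ F : {F : Set α // M.IsFlat F ∧ F ≠ M.E},
            (-1) ^ M.natRk F * Q (M ↾ (F : Set α)) *
              Polynomial.reflect (M.natRank - M.natRk F) (charPoly (M ／ (F : Set α))) := by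
        refine finsum_congr fun F => ?_
        rw [ih _ ?_ (M ↾ (F : Set α))
          (restrict_finite (hM.ground_finite.subset F.2.1.subset_ground)) rfl]
        rw [restrict_ground_eq]
        exact Set.ncard_lt_ncard (F.2.1.subset_ground.ssubset_of_ne F.2.2) hM.ground_finite
      rw [key]
      have hrecM := hrec M hM
      have hEE : M.natRk M.E = M.natRank := by rw [natRk, natRank, eRk_ground]
      rw [finsum_flats_split M M.E M.ground_isFlat (fun F => (-1) ^ M.natRk F * Q (M ↾ F) *
          Polynomial.reflect (M.natRank - M.natRk F) (charPoly (M ／ F))),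
        hEE, charPoly_eq_one (M ／ M.E) (by simp), restrict_ground_eq_self, Nat.sub_self,
        Polynomial.reflect_one, pow_zero, mul_one] at hrecM
      have hneg : ∀ R : ℤ[X], lowHalf M.natRank ((-1) ^ M.natRank * R)
          = (-1) ^ M.natRank * lowHalf M.natRank R := by
        intro R
        rcases neg_one_pow_eq_or ℤ[X] M.natRank with h | h <;> rw [h]
        · simp
        · ext i
          simp only [neg_mul, one_mul, Polynomial.coeff_neg, coeff_lowHalf]
          split_ifs <;> simp
      have h := congrArg (lowHalf M.natRank) hrecM
      rw [lowHalf_add, hneg, hneg, (lowHalf_reflect hd).1, (lowHalf_reflect hd).2, mul_zero] at h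
      have h2 := eq_neg_of_add_eq_zero_right h.symm
      rw [h2]
      have hsq : ((-1 : ℤ[X]) ^ M.natRank) * (-1) ^ M.natRank = 1 := by
        rw [← mul_pow]; simp
      linear_combination (-(Q M)) * hsq

end Matroid

/-
All three polynomials are convolutions over flats, and a convolution whose second factor vanishes
on matroids with loops may be summed over all subsets `A` of the ground set. Relaxing a stressed
hyperplane `H` of a rank `k` matroid `M` changes the summand only for `A ⊆ H` with fewer than `k`
elements, for `A = H`, and for `A = E`. In the first case `M|A` is Boolean and `M/A` is relaxed at
the stressed hyperplane `H \ A`, in the second `M|H` is uniform and `M/H` has rank one. By induction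
on the rank, the total change is thus a function of `k` and `|H|`.

In a paving matroid every hyperplane is stressed, and relaxing those with at least `k` elements one
after the other ends at a uniform matroid.
-/

universe v

namespace KazhdanLusztig

open Matroid
open Polynomial (X reflect)

section Rank

variable {α : Type u} {M : Matroid α} {A B C I : Set α}

theorem natRank_restrict (M : Matroid α) (A : Set α) : (M ↾ A).natRank = M.natRk A := by
  rw [natRank, natRk, eRank_restrict]

theorem natRk_ground (M : Matroid α) : M.natRk M.E = M.natRank := by
  rw [natRk, natRank, eRk_ground]

theorem natRk_eq_ncard_of_indep (hI : M.Indep I) : M.natRk I = I.ncard := by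
  rw [natRk, hI.eRk_eq_encard, Set.ncard]

theorem ground_nonempty_of_natRank_ne_zero (hM : M.natRank ≠ 0) : M.E.Nonempty := by
  rw [Set.nonempty_iff_ne_empty]
  intro hE
  rw [← natRk_ground, hE, natRk_eq_ncard_of_indep M.empty_indep, Set.ncard_empty] at hM
  exact hM rfl

theorem eRank_contract_add_eRk (M : Matroid α) (C : Set α) :
    (M ／ C).eRank + M.eRk C = M.eRank := by
  obtain ⟨I, hI⟩ := M.exists_isBasis' C
  rw [hI.eRk_eq_encard]
  apply le_antisymm
  · obtain ⟨J, hJ⟩ := (M ／ C).exists_isBase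
    obtain ⟨hJI, hCJ⟩ := hI.contract_indep_iff.1 hJ.indep
    rw [← hJ.encard_eq_eRank, ← Set.encard_union_eq (hCJ.symm.mono_right hI.subset)]
    exact hJI.encard_le_eRank
  · obtain ⟨B, hB, hIB⟩ := hI.indep.exists_isBase_superset
    have hCB : Disjoint C (B \ I) := by
      rw [Set.disjoint_left]
      exact fun e heC he => he.2 (hI.mem_of_insert_indep heC
        (hB.indep.subset (Set.insert_subset he.1 hIB)))
    have hind : (M ／ C).Indep (B \ I) := by
      rw [hI.contract_indep_iff, Set.sdiff_union_of_subset hIB]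
      exact ⟨hB.indep, hCB⟩
    rw [← hB.encard_eq_eRank, ← Set.encard_sdiff_add_encard_of_subset hIB]
    gcongr
    exact hind.encard_le_eRank

variable [M.Finite]

theorem coe_natRank (M : Matroid α) [M.Finite] : (M.natRank : ℕ∞) = M.eRank :=
  ENat.natCast_toNat (M.eRank_ne_top_iff.2 inferInstance)

theorem coe_natRk (M : Matroid α) [M.Finite] (A : Set α) : (M.natRk A : ℕ∞) = M.eRk A :=
  ENat.natCast_toNat (ne_top_of_le_ne_top (M.eRank_ne_top_iff.2 inferInstance) (M.eRk_le_eRank A))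

theorem natRk_mono (M : Matroid α) [M.Finite] (h : A ⊆ B) : M.natRk A ≤ M.natRk B := by
  exact_mod_cast coe_natRk M A ▸ coe_natRk M B ▸ M.eRk_mono h

theorem natRk_le_natRank (M : Matroid α) [M.Finite] (A : Set α) : M.natRk A ≤ M.natRank := by
  exact_mod_cast coe_natRk M A ▸ coe_natRank M ▸ M.eRk_le_eRank A

theorem ncard_le_natRank_of_indep (hI : M.Indep I) : I.ncard ≤ M.natRank :=
  natRk_eq_ncard_of_indep hI ▸ natRk_le_natRank M I

theorem encard_eq_eRank_iff (hA : A ⊆ M.E) : A.encard = M.eRank ↔ A.ncard = M.natRank := by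
  rw [← (M.ground_finite.subset hA).cast_ncard_eq, ← coe_natRank, Nat.cast_inj]

theorem natRank_contract_add_natRk (M : Matroid α) [M.Finite] (C : Set α) :
    (M ／ C).natRank + M.natRk C = M.natRank := by
  exact_mod_cast coe_natRank (M ／ C) ▸ coe_natRk M C ▸ coe_natRank M ▸ eRank_contract_add_eRk M C

theorem finite_restrict (M : Matroid α) [M.Finite] (hA : A ⊆ M.E) : (M ↾ A).Finite :=
  restrict_finite (M.ground_finite.subset hA)

theorem natRk_contract_add_natRk (M : Matroid α) [M.Finite] (hA : A ⊆ M.E) (hCA : C ⊆ A) :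
    (M ／ C).natRk (A \ C) + M.natRk C = M.natRk A := by
  have := finite_restrict M hA
  have h := natRank_contract_add_natRk (M ↾ A) C
  rw [restrict_contract_eq_contract_restrict M hCA, natRank_restrict, natRank_restrict] at h
  rwa [natRk, natRk, ← restrict_eRk_eq M hCA]

theorem closure_eq_closure_of_natRk_le (hA : A ⊆ M.E) (h : A ⊆ B) (hr : M.natRk B ≤ M.natRk A) :
    M.closure A = M.closure B := by
  refine (M.isRkFinite_of_finite
    (M.ground_finite.subset hA)).closure_eq_closure_of_subset_of_eRk_ge_eRk h ?_
  rw [← coe_natRk, ← coe_natRk]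
  exact_mod_cast hr

theorem natRk_insert_of_notMem_closure {e : α} (he : e ∈ M.E) (heA : e ∉ M.closure A) :
    M.natRk (insert e A) = M.natRk A + 1 := by
  exact_mod_cast coe_natRk M A ▸ coe_natRk M (insert e A) ▸ M.eRk_insert_eq_add_one ⟨he, heA⟩

theorem not_isFlat_of_natRk_eq (hA : A ⊂ M.E) (h : M.natRk A = M.natRank) : ¬ M.IsFlat A := by
  intro hflat
  refine hA.ne ?_
  rw [← hflat.closure, ← M.closure_ground,
    closure_eq_closure_of_natRk_le hA.subset hA.subset (by rw [h, natRk_ground])]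

theorem natRk_add_one_of_isHyperplane {H : Set α} (hH : M.IsHyperplane H) :
    M.natRk H + 1 = M.natRank := by
  exact_mod_cast coe_natRk M H ▸ coe_natRank M ▸ hH.2

end Rank

section Convolution

variable {α : Type u} {R : Type*} [Ring R] {M : Matroid α} {F : Set α}

/-- The convolution `∑_A f(M|A) g(M/A)` of two functions on matroids, the sum running over all
subsets `A` of the ground set. When `g` vanishes on matroids with loops this is the sum over all
flats, since `M / A` has a loop unless `A` is a flat. -/
noncomputable def conv (f g : Matroid α → R) (M : Matroid α) : R :=
  ∑ᶠ A ∈ 𝒫 M.E, f (M ↾ A) * g (M ／ A)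

/-- Matroid functions that are zero on every finite matroid with a loop. -/
def VanishesOnLoops (g : Matroid α → R) : Prop :=
  ∀ (M : Matroid α) [M.Finite] (e : α), M.IsLoop e → g M = 0

theorem isFlat_empty_contract (hF : M.IsFlat F) : (M ／ F).IsFlat ∅ := by
  rw [isFlat_iff_closure_eq, contract_closure_eq, Set.empty_union, hF.closure, Set.sdiff_self]

theorem exists_isLoop_contract (hFE : F ⊆ M.E) (hF : ¬ M.IsFlat F) : ∃ e, (M ／ F).IsLoop e := by
  by_contra! hno
  refine hF (isFlat_iff_closure_eq.2 ((M.subset_closure F hFE).antisymm' fun e he => ?_))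
  by_contra heF
  exact hno e (contract_isLoop_iff_mem_closure.2 ⟨he, heF⟩)

theorem VanishesOnLoops.contract_eq_zero [M.Finite] {g : Matroid α → R} (hg : VanishesOnLoops g)
    (hFE : F ⊆ M.E) (hF : ¬ M.IsFlat F) : g (M ／ F) = 0 := by
  obtain ⟨e, he⟩ := exists_isLoop_contract hFE hF
  exact hg _ e he

theorem finsum_subtype_eq_conv [M.Finite] {f g : Matroid α → R} {p : Set α → Prop}
    {φ : Set α → R} (hg : VanishesOnLoops g) (hp : ∀ F, p F → M.IsFlat F)
    (hφ : ∀ F, p F → φ F = f (M ↾ F) * g (M ／ F))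
    (hnot : ∀ F, M.IsFlat F → ¬ p F → f (M ↾ F) * g (M ／ F) = 0) :
    ∑ᶠ F : {F : Set α // p F}, φ F = conv f g M := by
  refine ((finsum_set_coe_eq_finsum_mem {F | p F}).trans (finsum_mem_congr rfl hφ)).trans ?_
  refine finsum_mem_inter_support_eq _ _ _ (Set.ext fun F => ?_)
  refine and_congr_left fun hF => ⟨fun h => (hp F h).subset_ground, fun hFE => ?_⟩
  by_contra hpF
  by_cases hflat : M.IsFlat F
  · exact hF (hnot F hflat hpF)
  · exact hF (mul_eq_zero_of_right _ (hg.contract_eq_zero hFE hflat))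

end Convolution

section Map

variable {α : Type u} {β : Type v} {R : Type*} [Ring R] {M : Matroid α} {φ : α → β}

theorem map_restrict (hφ : Set.InjOn φ M.E) {A : Set α} (hA : A ⊆ M.E) :
    M.map φ hφ ↾ (φ '' A) = (M ↾ A).map φ (hφ.mono hA) := by
  refine ext_indep rfl fun I hI => ?_
  obtain ⟨J, hJ, rfl⟩ := Set.subset_image_iff.1 hI
  rw [restrict_indep_iff, map_image_indep_iff (hJ.trans hA),
    map_image_indep_iff (M := M ↾ A) hJ, restrict_indep_iff]
  simp [hJ, Set.image_mono hJ]

theorem map_contract (hφ : Set.InjOn φ M.E) {C : Set α} (hC : C ⊆ M.E) :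
    M.map φ hφ ／ (φ '' C) = (M ／ C).map φ (hφ.mono Set.sdiff_subset) := by
  have hdual : (M.map φ hφ)✶ ＼ (φ '' C) = (M✶ ＼ C).map φ (hφ.mono Set.sdiff_subset) := by
    rw [map_dual]
    change M✶.map φ hφ ↾ (φ '' M.E \ φ '' C) = _
    rw [← hφ.image_sdiff_subset hC]
    exact map_restrict (M := M✶) hφ Set.sdiff_subset
  rw [← dual_delete_dual, hdual, map_dual]
  rfl

theorem conv_map (hφ : Set.InjOn φ M.E) {f g : Matroid α → R} {f' g' : Matroid β → R}
    (h : ∀ A, ∀ hA : A ⊆ M.E, f' ((M ↾ A).map φ (hφ.mono hA)) *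
      g' ((M ／ A).map φ (hφ.mono Set.sdiff_subset)) = f (M ↾ A) * g (M ／ A)) :
    conv f' g' (M.map φ hφ) = conv f g M := by
  have himage : 𝒫 (φ '' M.E) = Set.image φ '' 𝒫 M.E :=
    Set.ext fun B => by simp [Set.subset_image_iff]
  rw [conv, conv, map_ground, himage, finsum_mem_image hφ.image]
  exact finsum_mem_congr rfl fun A hA => by rw [map_restrict hφ hA, map_contract hφ hA, h A hA]

theorem natRank_map (hφ : Set.InjOn φ M.E) : (M.map φ hφ).natRank = M.natRank := by
  rw [natRank, natRank, eRank_map]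

end Map

section Polynomials

variable {α : Type u} {β : Type v} {M : Matroid α} {φ : α → β}

theorem charPoly_eq_conv (M : Matroid α) [M.Finite] :
    charPoly M = conv (fun N => (-1) ^ N.E.ncard) (fun N => X ^ N.natRank) M := by
  rw [charPoly, conv, ← finsum_set_coe_eq_finsum_mem]
  refine finsum_congr fun A => ?_
  rw [restrict_ground_eq, ← natRank_contract_add_natRk M A, Nat.add_sub_cancel]

open Classical in
/-- The characteristic polynomial, replaced by `0` for the empty ground set. Using it in a
convolution omits the terms of `F = ∅` or `F = E`, as the recursions defining the
Kazhdan--Lusztig polynomials do. -/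
noncomputable def properCharPoly (M : Matroid α) : ℤ[X] :=
  if M.E = ∅ then 0 else charPoly M

theorem properCharPoly_of_ground_eq_empty (h : M.E = ∅) : properCharPoly M = 0 := if_pos h

theorem properCharPoly_of_ground_ne_empty (h : M.E ≠ ∅) : properCharPoly M = charPoly M := if_neg h

/-- `t^{rk M} χ_M(t⁻¹)`, replaced by `0` for the empty ground set. -/
noncomputable def reverseProperCharPoly (M : Matroid α) : ℤ[X] :=
  reflect M.natRank (properCharPoly M)

theorem vanishesOnLoops_reverseProperCharPoly :
    VanishesOnLoops (reverseProperCharPoly (α := α)) := by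
  intro M _ e he
  rw [reverseProperCharPoly, properCharPoly, charPoly_eq_zero_of_isLoop M he, ite_self,
    Polynomial.reflect_zero]

/-- `(-1)^{rk M} Q_M`. -/
noncomputable def signedInvKLPoly (M : Matroid α) : ℤ[X] :=
  (-1) ^ M.natRank * invKLPoly M

theorem lowHalf_zero (k : ℕ) : lowHalf k 0 = 0 := by
  ext i
  simp [coeff_lowHalf]

theorem vanishesOnLoops_klPoly : VanishesOnLoops (klPoly (α := α)) := by
  intro M _ e he
  have hE : M.E ≠ ∅ := Set.nonempty_iff_ne_empty.1 ⟨e, he.mem_ground⟩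
  rw [klPoly, dif_pos ‹_›, if_neg hE, finsum_eq_zero_of_forall_eq_zero, lowHalf_zero, neg_zero,
    ite_self]
  intro F
  have := finite_restrict M F.2.1.subset_ground
  rw [charPoly_eq_zero_of_isLoop (M ↾ (F : Set α)) (e := e), zero_mul]
  exact restrict_isLoop_iff.2 ⟨he.mem_of_isFlat F.2.1, Or.inl he⟩

theorem klPoly_eq_conv (M : Matroid α) [M.Finite] (hM : M.natRank ≠ 0) :
    klPoly M = -lowHalf M.natRank (conv properCharPoly klPoly M) := by
  rw [klPoly, dif_pos ‹_›, if_neg hM]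
  congr 2
  refine finsum_subtype_eq_conv (φ := fun F => charPoly (M ↾ F) * klPoly (M ／ F))
    vanishesOnLoops_klPoly (fun F h => h.1) (fun F h => ?_) fun F hflat h => ?_
  · rw [properCharPoly_of_ground_ne_empty h.2]
  · have hF : F = ∅ := by_contra fun hne => h ⟨hflat, hne⟩
    rw [properCharPoly_of_ground_eq_empty hF, zero_mul]

theorem invKLPoly_eq_conv (M : Matroid α) [M.Finite] (hM : M.natRank ≠ 0) :
    invKLPoly M =
      -(-1) ^ M.natRank * lowHalf M.natRank (conv signedInvKLPoly reverseProperCharPoly M) := by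
  rw [invKLPoly, dif_pos ‹_›, if_neg hM]
  congr 2
  refine finsum_subtype_eq_conv (φ := fun F => (-1) ^ M.natRk F * invKLPoly (M ↾ F) *
      reflect (M.natRank - M.natRk F) (charPoly (M ／ F)))
    vanishesOnLoops_reverseProperCharPoly (fun F h => h.1) (fun F h => ?_) fun F hflat h => ?_
  · have hE : (M ／ F).E ≠ ∅ := fun hE =>
      h.2 (h.1.subset_ground.antisymm (Set.sdiff_eq_empty.1 hE))
    rw [reverseProperCharPoly, properCharPoly_of_ground_ne_empty hE, signedInvKLPoly,
      natRank_restrict, ← natRank_contract_add_natRk M F, Nat.add_sub_cancel]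
  · have hF : F = M.E := by_contra fun hne => h ⟨hflat, hne⟩
    rw [reverseProperCharPoly, properCharPoly_of_ground_eq_empty (by simp [hF]),
      Polynomial.reflect_zero, mul_zero]

theorem zPoly_eq_conv (M : Matroid α) [M.Finite] :
    zPoly M = conv (fun N => X ^ N.natRank) klPoly M :=
  finsum_subtype_eq_conv (φ := fun F => X ^ M.natRk F * klPoly (M ／ F)) vanishesOnLoops_klPoly
    (fun _ h => h) (fun F _ => by rw [natRank_restrict]) fun _ h hn => absurd h hn

theorem charPoly_map [M.Finite] (hφ : Set.InjOn φ M.E) : charPoly (M.map φ hφ) = charPoly M := by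
  rw [charPoly_eq_conv, charPoly_eq_conv]
  refine conv_map hφ fun A hA => ?_
  rw [map_ground, natRank_map, restrict_ground_eq, (hφ.mono hA).ncard_image]

theorem properCharPoly_map [M.Finite] (hφ : Set.InjOn φ M.E) :
    properCharPoly (M.map φ hφ) = properCharPoly M := by
  simp only [properCharPoly, map_ground, Set.image_eq_empty, charPoly_map]

open Classical in
theorem klPoly_of_natRank_eq_zero [M.Finite] (hM : M.natRank = 0) :
    klPoly M = if M.E = ∅ then 1 else 0 := by
  rw [klPoly, dif_pos ‹_›, if_pos hM]

open Classical in
theorem invKLPoly_of_natRank_eq_zero [M.Finite] (hM : M.natRank = 0) :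
    invKLPoly M = if M.E = ∅ then 1 else 0 := by
  rw [invKLPoly, dif_pos ‹_›, if_pos hM]

theorem klPoly_map [M.Finite] (hφ : Set.InjOn φ M.E) : klPoly (M.map φ hφ) = klPoly M := by
  induction hn : M.E.ncard using Nat.strong_induction_on generalizing M with
  | _ n ih =>
    by_cases hr : M.natRank = 0
    · simp [klPoly_of_natRank_eq_zero, natRank_map, hr]
    rw [klPoly_eq_conv _ hr, klPoly_eq_conv _ (by rwa [natRank_map]), natRank_map]
    congr 2
    refine conv_map hφ fun A hA => ?_
    have := finite_restrict M hA
    rw [properCharPoly_map]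
    rcases A.eq_empty_or_nonempty with rfl | ⟨x, hx⟩
    · rw [properCharPoly_of_ground_eq_empty restrict_ground_eq, zero_mul, zero_mul]
    · have hlt : (M ／ A).E.ncard < n := hn ▸ Set.ncard_lt_ncard
        ⟨Set.sdiff_subset, fun h => (h (hA hx)).2 hx⟩ M.ground_finite
      rw [ih _ hlt _ rfl]

theorem invKLPoly_map [M.Finite] (hφ : Set.InjOn φ M.E) :
    invKLPoly (M.map φ hφ) = invKLPoly M := by
  induction hn : M.E.ncard using Nat.strong_induction_on generalizing M with
  | _ n ih =>
    by_cases hr : M.natRank = 0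
    · simp [invKLPoly_of_natRank_eq_zero, natRank_map, hr]
    rw [invKLPoly_eq_conv _ hr, invKLPoly_eq_conv _ (by rwa [natRank_map]), natRank_map]
    congr 2
    refine conv_map hφ fun A hA => ?_
    have := finite_restrict M hA
    simp only [reverseProperCharPoly, signedInvKLPoly, natRank_map, properCharPoly_map]
    rcases eq_or_ssubset_of_subset hA with rfl | hss
    · simp [properCharPoly_of_ground_eq_empty]
    · have hlt : (M ↾ A).E.ncard < n := hn ▸ Set.ncard_lt_ncard hss M.ground_finite
      rw [ih _ hlt _ rfl]

theorem zPoly_map [M.Finite] (hφ : Set.InjOn φ M.E) : zPoly (M.map φ hφ) = zPoly M := by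
  rw [zPoly_eq_conv, zPoly_eq_conv]
  refine conv_map hφ fun A hA => ?_
  rw [natRank_map, klPoly_map]

end Polynomials

section Uniform

variable {α : Type u} {M : Matroid α} {k : ℕ}

/-- The independent sets of `M` are the subsets of the ground set with at most `k` elements, so
that `M` is isomorphic to `U_{k,n}` for `n = |E|`. -/
def IsUniform (M : Matroid α) (k : ℕ) : Prop :=
  ∀ I ⊆ M.E, M.Indep I ↔ I.ncard ≤ k

variable [M.Finite]

theorem IsUniform.exists_eq_map (hM : IsUniform M k) :
    ∃ (φ : Fin M.E.ncard → α) (hφ : Set.InjOn φ (uniform k M.E.ncard).E),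
      M = (uniform k M.E.ncard).map φ hφ := by
  have : Finite M.E := M.ground_finite.to_subtype
  let e : M.E ≃ Fin M.E.ncard := Finite.equivFin M.E
  have hinj : Function.Injective (fun i => (e.symm i : α)) :=
    Subtype.val_injective.comp e.symm.injective
  have hE : M.E = (fun i => (e.symm i : α)) '' (uniform k M.E.ncard).E := by
    change M.E = _ '' Set.univ
    rw [Set.image_univ, ← Function.comp_def, EquivLike.range_comp, Subtype.range_coe]
  refine ⟨fun i => e.symm i, hinj.injOn, ext_indep hE fun I hI => ?_⟩
  obtain ⟨J, hJ, rfl⟩ := Set.subset_image_iff.1 (hE ▸ hI)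
  rw [hM _ hI, map_image_indep_iff hJ, uniform_indep_iff, hinj.injOn.ncard_image]

theorem IsUniform.properCharPoly_eq (hM : IsUniform M k) :
    properCharPoly M = properCharPoly (uniform k M.E.ncard) := by
  obtain ⟨φ, hφ, h⟩ := hM.exists_eq_map
  exact (congrArg properCharPoly h).trans (properCharPoly_map hφ)

theorem IsUniform.klPoly_eq (hM : IsUniform M k) : klPoly M = klPoly (uniform k M.E.ncard) := by
  obtain ⟨φ, hφ, h⟩ := hM.exists_eq_map
  exact (congrArg klPoly h).trans (klPoly_map hφ)

theorem IsUniform.invKLPoly_eq (hM : IsUniform M k) :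
    invKLPoly M = invKLPoly (uniform k M.E.ncard) := by
  obtain ⟨φ, hφ, h⟩ := hM.exists_eq_map
  exact (congrArg invKLPoly h).trans (invKLPoly_map hφ)

theorem IsUniform.zPoly_eq (hM : IsUniform M k) : zPoly M = zPoly (uniform k M.E.ncard) := by
  obtain ⟨φ, hφ, h⟩ := hM.exists_eq_map
  exact (congrArg zPoly h).trans (zPoly_map hφ)

end Uniform

section Stressed

variable {α : Type u} {M : Matroid α} [M.Finite] {A F H I : Set α}

theorem finite_of_isStressedHyperplane (hH : M.IsStressedHyperplane H) : H.Finite :=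
  M.ground_finite.subset hH.1.1.subset_ground

theorem ssubset_ground_of_isHyperplane (hH : M.IsHyperplane H) : H ⊂ M.E := by
  refine hH.1.subset_ground.ssubset_of_ne ?_
  rintro rfl
  have := natRk_add_one_of_isHyperplane hH
  rw [natRk_ground] at this
  omega

theorem isCircuit_of_isStressedHyperplane (hH : M.IsStressedHyperplane H) (hA : A ⊆ H)
    (h : A.ncard = M.natRank) : M.IsCircuit A :=
  hH.2 A hA ((encard_eq_eRank_iff (hA.trans hH.1.1.subset_ground)).2 h)

theorem indep_of_isStressedHyperplane (hH : M.IsStressedHyperplane H)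
    (hk : M.natRank ≤ H.ncard) (hA : A ⊆ H) (h : A.ncard < M.natRank) : M.Indep A := by
  obtain ⟨S, hAS, hSH, hS⟩ := Set.exists_subsuperset_card_eq hA h.le hk
  exact (isCircuit_of_isStressedHyperplane hH hSH hS).ssubset_indep
    (hAS.ssubset_of_ne (by rintro rfl; omega))

theorem natRk_eq_of_isStressedHyperplane (hH : M.IsStressedHyperplane H) (hA : A ⊆ H)
    (h : M.natRank ≤ A.ncard) : M.natRk A = M.natRk H := by
  obtain ⟨S, hSA, hS⟩ := Set.exists_subset_card_eq h
  have hSrk : M.natRk S + 1 = M.natRank := by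
    rw [← hS]
    have hc := isCircuit_of_isStressedHyperplane hH (hSA.trans hA) hS
    exact_mod_cast coe_natRk M S ▸ hc.finite.cast_ncard_eq ▸ hc.eRk_add_one_eq
  have hSA' := natRk_mono M hSA
  have hAH := natRk_mono M hA
  have hHrk := natRk_add_one_of_isHyperplane hH.1
  omega

theorem closure_eq_of_isStressedHyperplane (hH : M.IsStressedHyperplane H) (hA : A ⊆ H)
    (h : M.natRank ≤ A.ncard) : M.closure A = H := by
  rw [closure_eq_closure_of_natRk_le (hA.trans hH.1.1.subset_ground) hA
    (natRk_eq_of_isStressedHyperplane hH hA h).ge, hH.1.1.closure]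

theorem natRk_eq_natRank_of_not_subset (hH : M.IsStressedHyperplane H) (hAE : A ⊆ M.E)
    (hA : ¬ A ⊆ H) (h : M.natRank ≤ (A ∩ H).ncard) : M.natRk A = M.natRank := by
  obtain ⟨e, he, heH⟩ := Set.not_subset.1 hA
  have hcl := closure_eq_of_isStressedHyperplane hH Set.inter_subset_right h
  have hinsert := natRk_insert_of_notMem_closure (M := M) (A := A ∩ H) (hAE he) (by rwa [hcl])
  have hle := natRk_mono M (Set.insert_subset he (Set.inter_subset_left (s := A) (t := H)))
  have hrk := natRk_eq_of_isStressedHyperplane hH Set.inter_subset_right h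
  have hHrk := natRk_add_one_of_isHyperplane hH.1
  exact (natRk_le_natRank M A).antisymm (by omega)

theorem natRank_contract_of_indep (hI : M.Indep I) :
    (M ／ I).natRank = M.natRank - I.ncard := by
  rw [← natRank_contract_add_natRk M I, natRk_eq_ncard_of_indep hI, Nat.add_sub_cancel]

theorem isHyperplane_contract (hH : M.IsHyperplane H) (hF : F ⊆ H) :
    (M ／ F).IsHyperplane (H \ F) := by
  constructor
  · rw [isFlat_iff_closure_eq, contract_closure_eq, Set.sdiff_union_of_subset hF, hH.1.closure]
  · have hrk := natRk_contract_add_natRk M hH.1.subset_ground hF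
    have hrank := natRank_contract_add_natRk M F
    have hHrk := natRk_add_one_of_isHyperplane hH
    rw [← coe_natRk, ← coe_natRank]
    norm_cast
    omega

theorem isStressedHyperplane_contract (hH : M.IsStressedHyperplane H)
    (hk : M.natRank ≤ H.ncard) (hF : F ⊆ H) (h : F.ncard < M.natRank) :
    (M ／ F).IsStressedHyperplane (H \ F) := by
  refine ⟨isHyperplane_contract hH.1 hF, fun S hS hSc => ?_⟩
  have hrank := natRank_contract_of_indep (indep_of_isStressedHyperplane hH hk hF h)
  have hSE : S ⊆ (M ／ F).E := hS.trans (Set.sdiff_subset_sdiff_left hH.1.1.subset_ground)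
  rw [encard_eq_eRank_iff hSE] at hSc
  have hSH := hS.trans Set.sdiff_subset
  have hHfin := finite_of_isStressedHyperplane hH
  have hdisj : Disjoint S F := Set.disjoint_of_subset_left hS Set.disjoint_sdiff_left
  have hcard : (S ∪ F).ncard = M.natRank := by
    rw [Set.ncard_union_eq hdisj (hHfin.subset hSH) (hHfin.subset hF)]
    omega
  have hss : F ⊂ S ∪ F := Set.subset_union_right.ssubset_of_ne (fun h' => by
    rw [← h'] at hcard
    omega)
  have hcircuit := isCircuit_of_isStressedHyperplane hH (Set.union_subset hSH hF) hcard
  simpa only [Set.union_sdiff_right, hdisj.sdiff_eq_left] using hcircuit.contract_isCircuit hss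

theorem natRank_contract_le_ncard_sdiff (hH : M.IsStressedHyperplane H) (hk : M.natRank ≤ H.ncard)
    (hA : A ⊆ H) (h : A.ncard < M.natRank) : (M ／ A).natRank ≤ (H \ A).ncard := by
  rw [natRank_contract_of_indep (indep_of_isStressedHyperplane hH hk hA h),
    Set.ncard_sdiff hA ((finite_of_isStressedHyperplane hH).subset hA)]
  omega

end Stressed

section Relax

variable {α : Type u} {M : Matroid α} [M.Finite] {A F H I : Set α}
  (hH : M.IsStressedHyperplane H)

instance finite_relax : (M.relax hH).Finite := ⟨M.ground_finite⟩

theorem isBase_relax_iff {B : Set α} :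
    (M.relax hH).IsBase B ↔ M.IsBase B ∨ (B ⊆ H ∧ B.encard = M.eRank) :=
  Iff.rfl

theorem indep_relax_iff :
    (M.relax hH).Indep I ↔ M.Indep I ∨ (I ⊆ H ∧ I.ncard = M.natRank) := by
  constructor
  · intro h
    obtain ⟨B, hB, hIB⟩ := h.exists_isBase_superset
    rcases (isBase_relax_iff hH).1 hB with hB | ⟨hBH, hBcard⟩
    · exact Or.inl (hB.indep.subset hIB)
    rcases eq_or_ssubset_of_subset hIB with rfl | hss
    · exact Or.inr ⟨hBH, (encard_eq_eRank_iff (hBH.trans hH.1.1.subset_ground)).1 hBcard⟩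
    · exact Or.inl ((hH.2 B hBH hBcard).ssubset_indep hss)
  · rintro (h | ⟨hIH, hcard⟩)
    · obtain ⟨B, hB, hIB⟩ := h.exists_isBase_superset
      exact ((isBase_relax_iff hH).2 (Or.inl hB)).indep.subset hIB
    · exact ((isBase_relax_iff hH).2
        (Or.inr ⟨hIH, (encard_eq_eRank_iff (hIH.trans hH.1.1.subset_ground)).2 hcard⟩)).indep

theorem eRank_relax : (M.relax hH).eRank = M.eRank := by
  obtain ⟨B, hB⟩ := M.exists_isBase
  rw [← hB.encard_eq_eRank, ← ((isBase_relax_iff hH).2 (Or.inl hB)).encard_eq_eRank]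

theorem natRank_relax : (M.relax hH).natRank = M.natRank := by
  rw [natRank, natRank, eRank_relax]

theorem relax_eq_self (hk : H.ncard < M.natRank) : M.relax hH = M := by
  refine ext_indep rfl fun I _ => ?_
  rw [indep_relax_iff, or_iff_left]
  rintro ⟨hIH, hcard⟩
  have := Set.ncard_le_ncard hIH (finite_of_isStressedHyperplane hH)
  omega

theorem relax_restrict (hA : (A ∩ H).ncard < M.natRank) : M.relax hH ↾ A = M ↾ A := by
  refine ext_indep rfl fun I (hIA : I ⊆ A) => ?_
  rw [restrict_indep_iff, restrict_indep_iff, indep_relax_iff, or_iff_left]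
  rintro ⟨hIH, hcard⟩
  have := Set.ncard_le_ncard (Set.subset_inter hIA hIH)
    ((finite_of_isStressedHyperplane hH).subset Set.inter_subset_right)
  omega

theorem natRk_relax_of_inter_ncard_lt (hA : (A ∩ H).ncard < M.natRank) :
    (M.relax hH).natRk A = M.natRk A := by
  rw [← natRank_restrict, relax_restrict hH hA, natRank_restrict]

theorem natRk_relax_eq_natRank (h : M.natRank ≤ (A ∩ H).ncard) :
    (M.relax hH).natRk A = M.natRank := by
  obtain ⟨S, hSA, hS⟩ := Set.exists_subset_card_eq h
  obtain ⟨hSA, hSH⟩ := Set.subset_inter_iff.1 hSA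
  have hSi : (M.relax hH).Indep S := (indep_relax_iff hH).2 (Or.inr ⟨hSH, hS⟩)
  refine (natRank_relax hH ▸ natRk_le_natRank (M.relax hH) A).antisymm ?_
  rw [← hS, ← natRk_eq_ncard_of_indep hSi]
  exact natRk_mono _ hSA

theorem natRk_relax_of_not_subset (hAE : A ⊆ M.E) (hA : ¬ A ⊆ H) :
    (M.relax hH).natRk A = M.natRk A := by
  rcases lt_or_ge (A ∩ H).ncard M.natRank with h | h
  · exact natRk_relax_of_inter_ncard_lt hH h
  · rw [natRk_relax_eq_natRank hH h, natRk_eq_natRank_of_not_subset hH hAE hA h]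

theorem natRk_relax_eq_natRk (hAE : A ⊆ M.E) (hA : ¬ (A ⊆ H ∧ M.natRank ≤ A.ncard)) :
    (M.relax hH).natRk A = M.natRk A := by
  by_cases hAH : A ⊆ H
  · have hlt : A.ncard < M.natRank := not_le.1 fun h => hA ⟨hAH, h⟩
    exact natRk_relax_of_inter_ncard_lt hH (by rwa [Set.inter_eq_left.2 hAH])
  · exact natRk_relax_of_not_subset hH hAE hAH

theorem relax_contract_of_not_subset (hFE : F ⊆ M.E) (hF : ¬ F ⊆ H) :
    M.relax hH ／ F = M ／ F := by
  obtain ⟨I, hI⟩ := M.exists_isBasis F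
  have hI' : (M.relax hH).IsBasis I F := by
    have hi : (M.relax hH).Indep I := (indep_relax_iff hH).2 (Or.inl hI.indep)
    refine hi.isBasis_of_eRk_ge (M.ground_finite.subset hI.indep.subset_ground) hI.subset ?_
    rw [hi.eRk_eq_encard, hI.encard_eq_eRk, ← coe_natRk, ← coe_natRk,
      natRk_relax_of_not_subset hH hFE hF]
  refine ext_indep rfl fun J _ => ?_
  rw [hI.contract_indep_iff, hI'.contract_indep_iff, indep_relax_iff, or_iff_left]
  rintro ⟨hJI, -⟩
  refine hF (hI.subset_closure.trans ?_)
  rw [← hH.1.1.closure]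
  exact M.closure_subset_closure (Set.subset_union_right.trans hJI)

theorem relax_contract_of_subset (hk : M.natRank ≤ H.ncard) (hF : F ⊆ H)
    (h : F.ncard < M.natRank) :
    M.relax hH ／ F = (M ／ F).relax (isStressedHyperplane_contract hH hk hF h) := by
  have hFi := indep_of_isStressedHyperplane hH hk hF h
  have hFi' : (M.relax hH).Indep F := (indep_relax_iff hH).2 (Or.inl hFi)
  refine ext_indep rfl fun J hJ => ?_
  have hJE : J ⊆ M.E \ F := hJ
  have hdisj : Disjoint J F := Set.disjoint_of_subset_left hJE Set.disjoint_sdiff_left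
  have hcard : (J ∪ F).ncard = J.ncard + F.ncard :=
    Set.ncard_union_eq hdisj (M.ground_finite.subset (hJE.trans Set.sdiff_subset))
      ((finite_of_isStressedHyperplane hH).subset hF)
  have hsub : J ∪ F ⊆ H ↔ J ⊆ H \ F := by
    simp only [Set.union_subset_iff, Set.subset_sdiff, hF, hdisj, and_true]
  rw [indep_relax_iff, hFi'.contract_indep_iff, hFi.contract_indep_iff, indep_relax_iff, hsub,
    hcard, natRank_contract_of_indep hFi, eq_tsub_iff_add_eq_of_le h.le]
  simp only [hdisj, true_and]

end Relax

section ConvolutionRelax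

variable {α : Type u} {R : Type*} [Ring R] {M : Matroid α} {A H : Set α}

theorem finsum_subset_ncard (hH : H.Finite) (p : ℕ → Prop) [DecidablePred p] (w : ℕ → R) :
    ∑ᶠ A ∈ {A | A ⊆ H ∧ p A.ncard}, w A.ncard =
      ∑ j ∈ Finset.range (H.ncard + 1) with p j, H.ncard.choose j • w j := by
  obtain ⟨S, rfl⟩ := hH.exists_finset_coe
  have himage : {A : Set α | A ⊆ S ∧ p A.ncard} =
      (fun A : Finset α => (A : Set α)) '' ↑(S.powerset.filter fun A => p A.card) := by
    ext A
    constructor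
    · rintro ⟨hAS, hA⟩
      obtain ⟨B, rfl⟩ := (S.finite_toSet.subset hAS).exists_finset_coe
      exact ⟨B, by simpa [Set.ncard_coe_finset] using And.intro hAS hA, rfl⟩
    · rintro ⟨B, hB, rfl⟩
      simpa using hB
  rw [himage, finsum_mem_image Finset.coe_injective.injOn, finsum_mem_coe_finset]
  simp only [Set.ncard_coe_finset, Finset.sum_filter]
  rw [Finset.sum_powerset_apply_card fun j => if p j then w j else 0]
  simp only [smul_ite, smul_zero]

variable [M.Finite] (hH : M.IsStressedHyperplane H) {f g : Matroid α → R}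

/-- The difference of the summands of `conv f g N` and `conv f g M` at `A`. -/
def convTermDiff (f g : Matroid α → R) (M N : Matroid α) (A : Set α) : R :=
  f (N ↾ A) * g (N ／ A) - f (M ↾ A) * g (M ／ A)

theorem convTermDiff_relax_eq_zero (hg : VanishesOnLoops g) (hAE : A ⊂ M.E) (hAH : A ≠ H)
    (hA : ¬ (A ⊆ H ∧ A.ncard < M.natRank)) : convTermDiff f g M (M.relax hH) A = 0 := by
  refine sub_eq_zero.2 ?_
  by_cases hsub : A ⊆ H
  · have hle : M.natRank ≤ A.ncard := not_lt.1 fun h => hA ⟨hsub, h⟩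
    have hrank : (M.relax hH).natRk A = (M.relax hH).natRank := by
      rw [natRank_relax, natRk_relax_eq_natRank hH (by rwa [Set.inter_eq_left.2 hsub])]
    have horig : ¬ M.IsFlat A := fun hflat =>
      hAH (hflat.closure.symm.trans (closure_eq_of_isStressedHyperplane hH hsub hle))
    rw [hg.contract_eq_zero hAE.subset horig,
      hg.contract_eq_zero (M := M.relax hH) hAE.subset (not_isFlat_of_natRk_eq hAE hrank),
      mul_zero, mul_zero]
  rw [relax_contract_of_not_subset hH hAE.subset hsub]
  rcases lt_or_ge (A ∩ H).ncard M.natRank with h | h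
  · rw [relax_restrict hH h]
  · have hflat := not_isFlat_of_natRk_eq hAE (natRk_eq_natRank_of_not_subset hH hAE.subset hsub h)
    rw [hg.contract_eq_zero hAE.subset hflat, mul_zero, mul_zero]

theorem convTermDiff_relax_ground :
    convTermDiff f g M (M.relax hH) M.E = (f (M.relax hH) - f M) * g (M ／ M.E) := by
  have hHE := ssubset_ground_of_isHyperplane hH.1
  rw [convTermDiff, relax_contract_of_not_subset hH subset_rfl hHE.not_subset, ← sub_mul]
  change (f (M.relax hH ↾ (M.relax hH).E) - _) * _ = _
  rw [restrict_ground_eq_self, restrict_ground_eq_self]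

theorem convTermDiff_relax_hyperplane (hg : VanishesOnLoops g) (hk : M.natRank ≤ H.ncard) :
    convTermDiff f g M (M.relax hH) H = -(f (M ↾ H) * g (M ／ H)) := by
  have hME : H ⊂ M.E := ssubset_ground_of_isHyperplane hH.1
  have hHE : H ⊂ (M.relax hH).E := hME
  have hrank : (M.relax hH).natRk H = (M.relax hH).natRank := by
    rw [natRank_relax, natRk_relax_eq_natRank hH (by rwa [Set.inter_self])]
  rw [convTermDiff, hg.contract_eq_zero hHE.subset (not_isFlat_of_natRk_eq hHE hrank), mul_zero,
    zero_sub]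

theorem convTermDiff_relax_of_ncard_lt (hAH : A ⊆ H) (hA : A.ncard < M.natRank) :
    convTermDiff f g M (M.relax hH) A = f (M ↾ A) * (g (M.relax hH ／ A) - g (M ／ A)) := by
  rw [convTermDiff, relax_restrict hH (by rwa [Set.inter_eq_left.2 hAH]), mul_sub]

theorem conv_relax_sub_conv (hg : VanishesOnLoops g) (hk : M.natRank ≤ H.ncard) :
    conv f g (M.relax hH) - conv f g M =
      convTermDiff f g M (M.relax hH) M.E + (convTermDiff f g M (M.relax hH) H +
        ∑ᶠ A ∈ {A | A ⊆ H ∧ A.ncard < M.natRank}, convTermDiff f g M (M.relax hH) A) := by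
  let S : Set (Set α) := {A | A ⊆ H ∧ A.ncard < M.natRank}
  have hHE := ssubset_ground_of_isHyperplane hH.1
  have hS : S.Finite := (finite_of_isStressedHyperplane hH).finite_subsets.subset fun A hA => hA.1
  have hHS : H ∉ S := fun h => h.2.not_ge hk
  have hES : M.E ∉ insert H S := by
    rintro (h | h)
    exacts [hHE.ne h.symm, hHE.not_subset h.1]
  rw [← finsum_mem_insert _ hHS hS, ← finsum_mem_insert _ hES (hS.insert H), conv, conv]
  refine (finsum_mem_sub_distrib _ _ M.ground_finite.finite_subsets).symm.trans
    (finsum_mem_inter_support_eq _ _ _ (Set.ext fun A => and_congr_left fun hDA => ⟨?_, ?_⟩))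
  · intro hAE
    by_contra! hA
    simp only [Set.mem_insert_iff, not_or] at hA
    exact hDA (convTermDiff_relax_eq_zero hH hg (hAE.ssubset_of_ne hA.1) hA.2.1 hA.2.2)
  · rintro (rfl | rfl | h)
    exacts [Set.Subset.rfl, hHE.subset, h.1.trans hHE.subset]

theorem conv_relax (hg : VanishesOnLoops g) (hk : M.natRank ≤ H.ncard) {w : ℕ → R}
    (hw : ∀ A ⊆ H, A.ncard < M.natRank →
      f (M ↾ A) * (g (M.relax hH ／ A) - g (M ／ A)) = w A.ncard) :
    conv f g (M.relax hH) = conv f g M +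
      (∑ j ∈ Finset.range M.natRank, H.ncard.choose j • w j +
        (f (M.relax hH) - f M) * g (M ／ M.E) - f (M ↾ H) * g (M ／ H)) := by
  have hsum : ∑ᶠ A ∈ {A | A ⊆ H ∧ A.ncard < M.natRank}, convTermDiff f g M (M.relax hH) A =
      ∑ j ∈ Finset.range M.natRank, H.ncard.choose j • w j := by
    rw [finsum_mem_congr rfl fun A hA =>
      (convTermDiff_relax_of_ncard_lt hH hA.1 hA.2).trans (hw A hA.1 hA.2)]
    refine (finsum_subset_ncard (finite_of_isStressedHyperplane hH) (· < M.natRank) w).trans ?_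
    congr 1
    ext j
    simp only [Finset.mem_filter, Finset.mem_range]
    omega
  rw [← sub_eq_iff_eq_add', conv_relax_sub_conv hH hg hk, convTermDiff_relax_ground,
    convTermDiff_relax_hyperplane hH hg hk, hsum]
  abel

end ConvolutionRelax

section RankOne

variable {α : Type u} {R : Type*} [Ring R] {M : Matroid α} [M.Finite] {A E : Set α}

theorem finsum_powerset_neg_one_pow_ncard (hE : E.Finite) (hne : E.Nonempty) :
    ∑ᶠ A ∈ 𝒫 E, (-1 : R) ^ A.ncard = 0 := by
  have h := finsum_subset_ncard hE (fun _ => True) fun j => (-1 : R) ^ j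
  have halt := congrArg (Int.cast : ℤ → R)
    (Int.alternating_sum_range_choose_of_ne (((Set.ncard_pos hE).2 hne).ne'))
  push_cast at halt
  simp only [and_true, Finset.filter_true, nsmul_eq_mul, Nat.cast_comm] at h
  exact h.trans halt

theorem charPoly_eq_finsum_mem (M : Matroid α) :
    charPoly M = ∑ᶠ A ∈ 𝒫 M.E, (-1) ^ A.ncard * X ^ (M.natRank - M.natRk A) :=
  finsum_set_coe_eq_finsum_mem (𝒫 M.E)
    (f := fun A => (-1 : ℤ[X]) ^ A.ncard * X ^ (M.natRank - M.natRk A))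

theorem natRk_eq_one_of_nonempty (hM : M.natRank = 1) (hflat : M.IsFlat ∅) (hA : A ⊆ M.E)
    (hne : A.Nonempty) : M.natRk A = 1 := by
  obtain ⟨e, he⟩ := hne
  have hinsert := natRk_insert_of_notMem_closure (A := ∅) (hA he) (by simp [hflat.closure])
  have hmono := natRk_mono M (Set.insert_subset he (Set.empty_subset A))
  have hle := natRk_le_natRank M A
  omega

theorem charPoly_of_natRank_eq_one (hM : M.natRank = 1) (hflat : M.IsFlat ∅) :
    charPoly M = X - 1 := by
  have hE : M.E.Nonempty := ground_nonempty_of_natRank_ne_zero (by omega)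
  have hpow : 𝒫 M.E = insert ∅ (𝒫 M.E \ {∅}) := by simp
  have hfin : (𝒫 M.E \ {∅}).Finite := M.ground_finite.finite_subsets.sdiff
  have halt := finsum_powerset_neg_one_pow_ncard (R := ℤ[X]) M.ground_finite hE
  rw [hpow, finsum_mem_insert _ (by simp) hfin, Set.ncard_empty, pow_zero] at halt
  have hterm : ∀ A ∈ 𝒫 M.E \ {∅},
      (-1 : ℤ[X]) ^ A.ncard * X ^ (M.natRank - M.natRk A) = (-1) ^ A.ncard := by
    rintro A ⟨hA, hne⟩
    rw [natRk_eq_one_of_nonempty hM hflat hA (Set.nonempty_iff_ne_empty.2 hne), hM, Nat.sub_self,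
      pow_zero, mul_one]
  rw [charPoly_eq_finsum_mem, hpow, finsum_mem_insert _ (by simp) hfin,
    finsum_mem_congr rfl hterm, natRk_eq_ncard_of_indep M.empty_indep, hM, Set.ncard_empty]
  linear_combination halt

theorem klPoly_contract_ground (M : Matroid α) [M.Finite] : klPoly (M ／ M.E) = 1 := by
  have h := natRank_contract_add_natRk M M.E
  rw [natRk_ground, Nat.add_eq_right] at h
  rw [klPoly_of_natRank_eq_zero h, contract_ground, if_pos Set.sdiff_self]

theorem klPoly_of_natRank_eq_one (hM : M.natRank = 1) (hflat : M.IsFlat ∅) : klPoly M = 1 := by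
  have hE : M.E.Nonempty := ground_nonempty_of_natRank_ne_zero (by omega)
  have hzero : ∀ A ⊂ M.E, properCharPoly (M ↾ A) * klPoly (M ／ A) = 0 := by
    intro A hA
    rcases A.eq_empty_or_nonempty with rfl | hne
    · rw [properCharPoly_of_ground_eq_empty restrict_ground_eq, zero_mul]
    · rw [vanishesOnLoops_klPoly.contract_eq_zero hA.subset, mul_zero]
      exact not_isFlat_of_natRk_eq hA (hM ▸ natRk_eq_one_of_nonempty hM hflat hA.subset hne)
  have hconv : conv properCharPoly klPoly M = X - 1 := by
    have hground : properCharPoly (M ↾ M.E) * klPoly (M ／ M.E) = X - 1 := by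
      rw [klPoly_contract_ground, mul_one, restrict_ground_eq_self,
        properCharPoly_of_ground_ne_empty hE.ne_empty, charPoly_of_natRank_eq_one hM hflat]
    rw [← hground, conv]
    refine (finsum_mem_inter_support_eq _ _ {M.E} (Set.ext fun A =>
      and_congr_left fun hA => ⟨fun hAE => ?_, ?_⟩)).trans finsum_mem_singleton
    · by_contra hne
      exact hA (hzero A (LE.le.ssubset_of_ne hAE hne))
    · rintro rfl
      exact Set.Subset.rfl
  rw [klPoly_eq_conv M (by omega), hconv, hM]
  ext i
  rcases i with _ | i <;> simp [coeff_lowHalf, Polynomial.coeff_one]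

end RankOne

section Increments

variable {α : Type u} {M : Matroid α} [M.Finite] {A H : Set α}

/-- The characteristic polynomial of the relaxation of a stressed hyperplane with `h ≥ k` elements
minus that of the original matroid, where `k ≥ 1` is the rank. -/
noncomputable def charIncrement (k h : ℕ) : ℤ[X] :=
  (-1) ^ k * ((h - 1).choose (k - 1) : ℤ[X]) * (1 - X)

theorem alternating_sum_filter_le_choose {k h : ℕ} (hk : 1 ≤ k) (hkh : k ≤ h) :
    ∑ j ∈ Finset.range (h + 1) with k ≤ j, (-1) ^ j * (h.choose j : ℤ) =
      (-1) ^ k * (h - 1).choose (k - 1) := by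
  obtain ⟨k, rfl⟩ := Nat.exists_eq_add_of_le' hk
  obtain ⟨h, rfl⟩ := Nat.exists_eq_add_of_le' (hk.trans hkh)
  have hlt : (Finset.range (h + 1 + 1)).filter (fun j => ¬ k + 1 ≤ j) = Finset.range (k + 1) := by
    ext j
    simp only [Finset.mem_filter, Finset.mem_range]
    omega
  have hsplit := Finset.sum_filter_add_sum_filter_not (Finset.range (h + 1 + 1)) (k + 1 ≤ ·)
    fun j => (-1) ^ j * ((h + 1).choose j : ℤ)
  rw [hlt, Int.alternating_sum_range_choose_eq_choose,
    Int.alternating_sum_range_choose_of_ne h.succ_ne_zero] at hsplit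
  simp only [Nat.add_sub_cancel, pow_succ]
  linear_combination hsplit

theorem charPoly_relax_sub_charPoly (hH : M.IsStressedHyperplane H) :
    charPoly (M.relax hH) - charPoly M =
      ∑ᶠ A ∈ {A | A ⊆ H ∧ M.natRank ≤ A.ncard}, (-1) ^ A.ncard * (1 - X) := by
  have hdiff : ∀ A ∈ {A | A ⊆ H ∧ M.natRank ≤ A.ncard},
      (-1) ^ A.ncard * X ^ ((M.relax hH).natRank - (M.relax hH).natRk A) -
        (-1) ^ A.ncard * X ^ (M.natRank - M.natRk A) = (-1) ^ A.ncard * (1 - X : ℤ[X]) := by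
    rintro A ⟨hAH, hA⟩
    rw [natRank_relax, natRk_relax_eq_natRank hH (by rwa [Set.inter_eq_left.2 hAH]),
      natRk_eq_of_isStressedHyperplane hH hAH hA, ← natRk_add_one_of_isHyperplane hH.1]
    simp [mul_sub]
  rw [charPoly_eq_finsum_mem, charPoly_eq_finsum_mem, ← finsum_mem_congr rfl hdiff]
  refine (finsum_mem_sub_distrib _ _ M.ground_finite.finite_subsets).symm.trans
    (finsum_mem_inter_support_eq _ _ _ (Set.ext fun A => and_congr_left fun hA =>
      ⟨fun hAE => ?_, fun h => h.1.trans hH.1.1.subset_ground⟩))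
  by_contra hnot
  refine hA (sub_eq_zero.2 ?_)
  rw [natRank_relax, natRk_relax_eq_natRk hH hAE hnot]

theorem charPoly_relax (hH : M.IsStressedHyperplane H) (hk : M.natRank ≤ H.ncard) :
    charPoly (M.relax hH) = charPoly M + charIncrement M.natRank H.ncard := by
  have hHrk := natRk_add_one_of_isHyperplane hH.1
  have hsum := congrArg (Int.cast : ℤ → ℤ[X]) (alternating_sum_filter_le_choose (by omega) hk)
  push_cast at hsum
  rw [← sub_eq_iff_eq_add', charPoly_relax_sub_charPoly, charIncrement, ← hsum, Finset.sum_mul]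
  refine (finsum_subset_ncard (finite_of_isStressedHyperplane hH) (M.natRank ≤ ·)
    fun j => (-1) ^ j * (1 - X)).trans (Finset.sum_congr rfl fun j _ => ?_)
  rw [nsmul_eq_mul]
  ring

theorem isUniform_restrict_of_indep (hA : M.Indep A) : IsUniform (M ↾ A) A.ncard := by
  intro I (hIA : I ⊆ A)
  exact iff_of_true (restrict_indep_iff.2 ⟨hA.subset hIA, hIA⟩)
    (Set.ncard_le_ncard hIA (M.ground_finite.subset hA.subset_ground))

theorem isUniform_restrict_of_isStressedHyperplane (hH : M.IsStressedHyperplane H)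
    (hk : M.natRank ≤ H.ncard) : IsUniform (M ↾ H) (M.natRank - 1) := by
  intro I (hIH : I ⊆ H)
  have hHrk := natRk_add_one_of_isHyperplane hH.1
  rw [restrict_indep_iff, and_iff_left hIH]
  refine ⟨fun hI => ?_, fun hI => indep_of_isStressedHyperplane hH hk hIH (by omega)⟩
  have hmono := natRk_mono M hIH
  rw [natRk_eq_ncard_of_indep hI] at hmono
  omega

theorem natRank_contract_of_isHyperplane (hH : M.IsHyperplane H) : (M ／ H).natRank = 1 := by
  have hrank := natRank_contract_add_natRk M H
  have hHrk := natRk_add_one_of_isHyperplane hH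
  omega

theorem klPoly_contract_of_isHyperplane (hH : M.IsHyperplane H) : klPoly (M ／ H) = 1 :=
  klPoly_of_natRank_eq_one (natRank_contract_of_isHyperplane hH) (isFlat_empty_contract hH.1)

theorem reverseProperCharPoly_contract_of_isHyperplane (hH : M.IsHyperplane H) :
    reverseProperCharPoly (M ／ H) = 1 - X := by
  have hrank := natRank_contract_of_isHyperplane hH
  have hE := ground_nonempty_of_natRank_ne_zero (M := M ／ H) (by omega)
  rw [reverseProperCharPoly, properCharPoly_of_ground_ne_empty hE.ne_empty,
    charPoly_of_natRank_eq_one hrank (isFlat_empty_contract hH.1), hrank, Polynomial.reflect_sub,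
    Polynomial.reflect_one, pow_one]
  simp

/-- The polynomial `p_{k,h}`, obtained by comparing the recursions for the Kazhdan--Lusztig
polynomials of a matroid and its relaxation. The `i`-th summand stands for the subsets of the
hyperplane with `i + 1` elements. -/
noncomputable def klIncrement : ℕ → ℕ → ℤ[X]
  | 0, _ => 0
  | k + 1, h => if h < k + 1 then 0 else -lowHalf (k + 1)
      (∑ i ∈ Finset.range k, h.choose (i + 1) •
          (properCharPoly (uniform (i + 1) (i + 1)) * klIncrement (k - i) (h - (i + 1))) +
        charIncrement (k + 1) h - properCharPoly (uniform k h))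

/-- The polynomial `q_{k,h}`. The `j`-th summand stands for the subsets of the hyperplane with
`j` elements. -/
noncomputable def invKLIncrement (k h : ℕ) : ℤ[X] :=
  if h < k then 0 else -(-1) ^ k * lowHalf k
    (∑ j ∈ Finset.range k, h.choose j •
        ((-1) ^ j * invKLPoly (uniform j j) * reflect (k - j) (charIncrement (k - j) (h - j))) -
      (-1) ^ (k - 1) * invKLPoly (uniform (k - 1) h) * (1 - X))

/-- The polynomial `z_{k,h}`. The `j`-th summand stands for the subsets of the hyperplane with
`j` elements. -/
noncomputable def zIncrement (k h : ℕ) : ℤ[X] :=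
  if h < k then 0 else
    ∑ j ∈ Finset.range k, h.choose j • (X ^ j * klIncrement (k - j) (h - j)) - X ^ (k - 1)

theorem klIncrement_of_lt {k h : ℕ} (hk : h < k) : klIncrement k h = 0 := by
  cases k with
  | zero => rw [klIncrement]
  | succ k => rw [klIncrement, if_pos hk]

theorem klIncrement_of_le {k h : ℕ} (hk : k ≠ 0) (hkh : k ≤ h) :
    klIncrement k h = -lowHalf k
      (∑ j ∈ Finset.range k, h.choose j •
          (properCharPoly (uniform j j) * klIncrement (k - j) (h - j)) +
        charIncrement k h - properCharPoly (uniform (k - 1) h)) := by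
  obtain ⟨k, rfl⟩ := Nat.exists_eq_succ_of_ne_zero hk
  have hempty : (uniform 0 0).E = ∅ := Set.eq_empty_of_isEmpty _
  rw [klIncrement, if_neg hkh.not_gt, Finset.sum_range_succ',
    properCharPoly_of_ground_eq_empty hempty, zero_mul, smul_zero, add_zero]
  simp only [Nat.succ_eq_add_one, Nat.add_sub_add_right, Nat.add_sub_cancel]

end Increments

section RelaxPolynomials

variable {α : Type u} {M : Matroid α} [M.Finite] {A H : Set α} (hH : M.IsStressedHyperplane H)

theorem relax_contract_sub_contract {R : Type*} [AddCommGroup R] {g : Matroid α → R}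
    {φ : ℕ → ℕ → R} (hk : M.natRank ≤ H.ncard) (hA : A ⊆ H) (h : A.ncard < M.natRank)
    (hg : g ((M ／ A).relax (isStressedHyperplane_contract hH hk hA h)) =
      g (M ／ A) + φ (M ／ A).natRank (H \ A).ncard) :
    g (M.relax hH ／ A) - g (M ／ A) = φ (M.natRank - A.ncard) (H.ncard - A.ncard) := by
  have hHfin := finite_of_isStressedHyperplane hH
  rw [relax_contract_of_subset hH hk hA h, hg, add_sub_cancel_left,
    natRank_contract_of_indep (indep_of_isStressedHyperplane hH hk hA h),
    Set.ncard_sdiff hA (hHfin.subset hA)]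

theorem properCharPoly_relax (hk : M.natRank ≤ H.ncard) :
    properCharPoly (M.relax hH) = properCharPoly M + charIncrement M.natRank H.ncard := by
  have hE : M.E ≠ ∅ := (Set.nonempty_of_ssubset' (ssubset_ground_of_isHyperplane hH.1)).ne_empty
  rw [properCharPoly_of_ground_ne_empty hE, properCharPoly_of_ground_ne_empty (M := M.relax hH) hE,
    charPoly_relax hH hk]

theorem klPoly_relax :
    klPoly (M.relax hH) = klPoly M + klIncrement M.natRank H.ncard := by
  induction hr : M.natRank using Nat.strong_induction_on generalizing M H with
  | _ r ih =>
    subst hr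
    rcases lt_or_ge H.ncard M.natRank with hlt | hk
    · rw [klIncrement_of_lt hlt, relax_eq_self hH hlt, add_zero]
    have hrank : M.natRank ≠ 0 := by
      rw [← natRk_add_one_of_isHyperplane hH.1]
      exact Nat.succ_ne_zero _
    have hterm : ∀ A ⊆ H, A.ncard < M.natRank →
        properCharPoly (M ↾ A) * (klPoly (M.relax hH ／ A) - klPoly (M ／ A)) =
          properCharPoly (uniform A.ncard A.ncard) *
            klIncrement (M.natRank - A.ncard) (H.ncard - A.ncard) := by
      intro A hAH hA
      have := finite_restrict M (hAH.trans hH.1.1.subset_ground)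
      have hAi := indep_of_isStressedHyperplane hH hk hAH hA
      rw [(isUniform_restrict_of_indep hAi).properCharPoly_eq, restrict_ground_eq]
      rcases A.eq_empty_or_nonempty with rfl | hne
      · rw [Set.ncard_empty,
          properCharPoly_of_ground_eq_empty (Set.eq_empty_of_isEmpty _), zero_mul, zero_mul]
      · have hpos := (Set.ncard_pos ((finite_of_isStressedHyperplane hH).subset hAH)).2 hne
        have hlt : (M ／ A).natRank < M.natRank := by
          rw [natRank_contract_of_indep hAi]
          omega
        rw [relax_contract_sub_contract hH hk hAH hA (ih _ hlt _ rfl)]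
    have := finite_restrict M hH.1.1.subset_ground
    rw [klPoly_eq_conv _ (by rwa [natRank_relax]), klPoly_eq_conv M hrank, natRank_relax,
      conv_relax hH vanishesOnLoops_klPoly hk (w := fun j => properCharPoly (uniform j j) *
        klIncrement (M.natRank - j) (H.ncard - j)) hterm, lowHalf_add, neg_add,
      properCharPoly_relax hH hk, add_sub_cancel_left, klPoly_contract_ground,
      klPoly_contract_of_isHyperplane hH.1, mul_one, mul_one,
      (isUniform_restrict_of_isStressedHyperplane hH hk).properCharPoly_eq, restrict_ground_eq,
      klIncrement_of_le hrank hk]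

theorem reverseProperCharPoly_relax (hk : M.natRank ≤ H.ncard) :
    reverseProperCharPoly (M.relax hH) =
      reverseProperCharPoly M + reflect M.natRank (charIncrement M.natRank H.ncard) := by
  rw [reverseProperCharPoly, natRank_relax, properCharPoly_relax hH hk, Polynomial.reflect_add,
    reverseProperCharPoly]

theorem invKLPoly_relax :
    invKLPoly (M.relax hH) = invKLPoly M + invKLIncrement M.natRank H.ncard := by
  rcases lt_or_ge H.ncard M.natRank with hlt | hk
  · rw [invKLIncrement, if_pos hlt, relax_eq_self hH hlt, add_zero]
  have hHrk := natRk_add_one_of_isHyperplane hH.1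
  let w : ℕ → ℤ[X] := fun j => (-1) ^ j * invKLPoly (uniform j j) *
    reflect (M.natRank - j) (charIncrement (M.natRank - j) (H.ncard - j))
  have hterm : ∀ A ⊆ H, A.ncard < M.natRank → signedInvKLPoly (M ↾ A) *
      (reverseProperCharPoly (M.relax hH ／ A) - reverseProperCharPoly (M ／ A)) = w A.ncard := by
    intro A hAH hA
    have := finite_restrict M (hAH.trans hH.1.1.subset_ground)
    have hAi := indep_of_isStressedHyperplane hH hk hAH hA
    rw [relax_contract_sub_contract hH hk hAH hA (φ := fun k h => reflect k (charIncrement k h))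
        (reverseProperCharPoly_relax _ (natRank_contract_le_ncard_sdiff hH hk hAH hA)),
      signedInvKLPoly, natRank_restrict, natRk_eq_ncard_of_indep hAi,
      (isUniform_restrict_of_indep hAi).invKLPoly_eq, restrict_ground_eq]
  have := finite_restrict M hH.1.1.subset_ground
  have hground : reverseProperCharPoly (M ／ M.E) = 0 := by
    rw [reverseProperCharPoly, properCharPoly_of_ground_eq_empty (Set.sdiff_self),
      Polynomial.reflect_zero]
  have hsigned : signedInvKLPoly (M ↾ H) =
      (-1) ^ (M.natRank - 1) * invKLPoly (uniform (M.natRank - 1) H.ncard) := by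
    rw [signedInvKLPoly, (isUniform_restrict_of_isStressedHyperplane hH hk).invKLPoly_eq,
      natRank_restrict, restrict_ground_eq, Nat.eq_sub_of_add_eq hHrk]
  rw [invKLPoly_eq_conv _ (by rw [natRank_relax]; omega), invKLPoly_eq_conv M (by omega),
    natRank_relax, conv_relax hH vanishesOnLoops_reverseProperCharPoly hk hterm, lowHalf_add,
    mul_add, hground, mul_zero, add_zero, reverseProperCharPoly_contract_of_isHyperplane hH.1,
    hsigned, invKLIncrement, if_neg hk.not_gt]

theorem zPoly_relax : zPoly (M.relax hH) = zPoly M + zIncrement M.natRank H.ncard := by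
  rcases lt_or_ge H.ncard M.natRank with hlt | hk
  · rw [zIncrement, if_pos hlt, relax_eq_self hH hlt, add_zero]
  have hHrk := natRk_add_one_of_isHyperplane hH.1
  let w : ℕ → ℤ[X] := fun j => X ^ j * klIncrement (M.natRank - j) (H.ncard - j)
  have hterm : ∀ A ⊆ H, A.ncard < M.natRank →
      X ^ (M ↾ A).natRank * (klPoly (M.relax hH ／ A) - klPoly (M ／ A)) = w A.ncard := by
    intro A hAH hA
    rw [relax_contract_sub_contract hH hk hAH hA (klPoly_relax _), natRank_restrict,
      natRk_eq_ncard_of_indep (indep_of_isStressedHyperplane hH hk hAH hA)]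
  have hground : X ^ (M.relax hH).natRank - X ^ M.natRank = (0 : ℤ[X]) := by
    rw [natRank_relax, sub_self]
  rw [zPoly_eq_conv, zPoly_eq_conv,
    conv_relax hH (f := fun N => X ^ N.natRank) vanishesOnLoops_klPoly hk hterm, hground,
    zero_mul, add_zero, klPoly_contract_of_isHyperplane hH.1, mul_one, natRank_restrict,
    Nat.eq_sub_of_add_eq hHrk, zIncrement, if_neg hk.not_gt]

end RelaxPolynomials

section Paving

variable {α : Type u} {M : Matroid α} [M.Finite] {A H I : Set α}

theorem indep_of_isPaving_of_ncard_lt (hM : M.IsPaving) (hI : I ⊆ M.E)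
    (h : I.ncard < M.natRank) : M.Indep I := by
  rw [indep_iff_forall_subset_not_isCircuit hI]
  intro C hCI hC
  have hIfin := M.ground_finite.subset hI
  have hrank := hM C hC
  rw [← coe_natRank, ← (hIfin.subset hCI).cast_ncard_eq, Nat.cast_le] at hrank
  have hcard := Set.ncard_le_ncard hCI hIfin
  omega

theorem isCircuit_of_isPaving (hM : M.IsPaving) (hI : M.Dep I) (h : I.ncard = M.natRank) :
    M.IsCircuit I := by
  refine isCircuit_iff_forall_ssubset.2 ⟨hI, fun J hJ =>
    indep_of_isPaving_of_ncard_lt hM (hJ.subset.trans hI.subset_ground) ?_⟩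
  rw [← h]
  exact Set.ncard_lt_ncard hJ (M.ground_finite.subset hI.subset_ground)

theorem isStressedHyperplane_of_isPaving (hM : M.IsPaving) (hH : M.IsHyperplane H) :
    M.IsStressedHyperplane H := by
  refine ⟨hH, fun S hS hScard => ?_⟩
  have hSE := hS.trans hH.1.subset_ground
  rw [encard_eq_eRank_iff hSE] at hScard
  refine isCircuit_of_isPaving hM ⟨fun hSi => ?_, hSE⟩ hScard
  have hmono := natRk_mono M hS
  have hHrk := natRk_add_one_of_isHyperplane hH
  rw [natRk_eq_ncard_of_indep hSi] at hmono
  omega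

theorem isPaving_relax (hM : M.IsPaving) (hH : M.IsStressedHyperplane H) :
    (M.relax hH).IsPaving := by
  intro C hC
  have hCE : C ⊆ M.E := hC.subset_ground
  by_contra! hlt
  rw [← coe_natRank, natRank_relax, ← (M.ground_finite.subset hCE).cast_ncard_eq,
    Nat.cast_lt] at hlt
  exact hC.not_indep ((indep_relax_iff hH).2 (Or.inl (indep_of_isPaving_of_ncard_lt hM hCE hlt)))

theorem isFlat_iff_natRk_lt (hA : A ⊆ M.E) :
    M.IsFlat A ↔ ∀ e ∈ M.E, e ∉ A → M.natRk A < M.natRk (insert e A) := by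
  constructor
  · intro hflat e he heA
    rw [natRk_insert_of_notMem_closure he (by rwa [hflat.closure])]
    exact Nat.lt_succ_self _
  · intro h
    refine isFlat_iff_closure_eq.2 (subset_antisymm (fun e he => ?_) (M.subset_closure A hA))
    by_contra heA
    refine (h e (M.closure_subset_ground A he) heA).ne ?_
    rw [natRk, natRk, ← M.eRk_closure_eq (insert e A), closure_insert_eq_of_mem_closure he,
      M.eRk_closure_eq]

theorem isHyperplane_relax_iff_of_not_subset (hH : M.IsStressedHyperplane H) (hAE : A ⊆ M.E)
    (hAH : ¬ A ⊆ H) : (M.relax hH).IsHyperplane A ↔ M.IsHyperplane A := by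
  rw [IsHyperplane, IsHyperplane, eRank_relax, ← coe_natRk, ← coe_natRk,
    natRk_relax_of_not_subset hH hAE hAH, isFlat_iff_natRk_lt hAE,
    isFlat_iff_natRk_lt (M := M.relax hH) hAE]
  refine and_congr_left fun _ => forall₃_congr fun e he _ => ?_
  rw [natRk_relax_of_not_subset hH hAE hAH, natRk_relax_of_not_subset hH
    (Set.insert_subset he hAE) fun h => hAH ((Set.subset_insert e A).trans h)]

theorem isHyperplane_relax_iff (hH : M.IsStressedHyperplane H) (hA : M.natRank ≤ A.ncard) :
    (M.relax hH).IsHyperplane A ↔ M.IsHyperplane A ∧ A ≠ H := by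
  by_cases hAH : A ⊆ H
  · refine iff_of_false (fun h => ?_) fun h => h.2 ?_
    · have hrk := natRk_add_one_of_isHyperplane h
      rw [natRk_relax_eq_natRank hH (by rwa [Set.inter_eq_left.2 hAH]), natRank_relax] at hrk
      omega
    · rw [← h.1.1.closure, closure_eq_of_isStressedHyperplane hH hAH hA]
  · rw [and_iff_left fun h : A = H => hAH h.subset]
    by_cases hAE : A ⊆ M.E
    · exact isHyperplane_relax_iff_of_not_subset hH hAE hAH
    · exact iff_of_false (fun h => hAE h.1.subset_ground) fun h => hAE h.1.subset_ground

theorem finite_setOf_isHyperplane (M : Matroid α) [M.Finite] (h : ℕ) :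
    {A | M.IsHyperplane A ∧ A.ncard = h}.Finite :=
  M.ground_finite.finite_subsets.subset fun _ hA => hA.1.1.subset_ground

theorem numHyperplanes_relax (hH : M.IsStressedHyperplane H) {h : ℕ} (hh : M.natRank ≤ h) :
    M.numHyperplanes h = (M.relax hH).numHyperplanes h + if h = H.ncard then 1 else 0 := by
  have hset : {A | (M.relax hH).IsHyperplane A ∧ A.ncard = h} =
      {A | M.IsHyperplane A ∧ A.ncard = h} \ {H} := by
    ext A
    constructor
    · rintro ⟨hA, rfl⟩
      obtain ⟨hA, hne⟩ := (isHyperplane_relax_iff hH hh).1 hA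
      exact ⟨⟨hA, rfl⟩, hne⟩
    · rintro ⟨⟨hA, rfl⟩, hne⟩
      exact ⟨(isHyperplane_relax_iff hH hh).2 ⟨hA, hne⟩, rfl⟩
  rw [numHyperplanes, numHyperplanes, hset]
  split_ifs with hcard
  · have hmem : H ∈ {A | M.IsHyperplane A ∧ A.ncard = h} := ⟨hH.1, hcard.symm⟩
    rw [Set.ncard_sdiff_singleton_add_one hmem (finite_setOf_isHyperplane M h)]
  · rw [Set.sdiff_singleton_eq_self fun hmem => hcard hmem.2.symm, add_zero]

theorem sum_numHyperplanes_relax {R : Type*} [Semiring R] (hH : M.IsStressedHyperplane H)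
    (hk : M.natRank ≤ H.ncard) (φ : ℕ → R) :
    ∑ h ∈ Finset.Icc M.natRank M.E.ncard, (M.numHyperplanes h : R) * φ h =
      ∑ h ∈ Finset.Icc M.natRank M.E.ncard, ((M.relax hH).numHyperplanes h : R) * φ h +
        φ H.ncard := by
  have hmem : H.ncard ∈ Finset.Icc M.natRank M.E.ncard :=
    Finset.mem_Icc.2 ⟨hk, Set.ncard_le_ncard hH.1.1.subset_ground M.ground_finite⟩
  rw [← if_pos hmem (t := φ H.ncard) (e := 0), ← Finset.sum_ite_eq' _ _ φ,
    ← Finset.sum_add_distrib]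
  refine Finset.sum_congr rfl fun h hh => ?_
  rw [numHyperplanes_relax hH (Finset.mem_Icc.1 hh).1]
  split_ifs <;> simp [add_mul]

theorem isUniform_of_isPaving (hM : M.IsPaving)
    (hsmall : ∀ H, M.IsHyperplane H → H.ncard < M.natRank) : IsUniform M M.natRank := by
  intro I hI
  refine ⟨ncard_le_natRank_of_indep, fun h => by_contra fun hdep => ?_⟩
  have hcard : I.ncard = M.natRank :=
    h.antisymm (not_lt.1 fun hlt => hdep (indep_of_isPaving_of_ncard_lt hM hI hlt))
  have hcircuit : M.IsCircuit I := isCircuit_of_isPaving hM ⟨hdep, hI⟩ hcard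
  have hhyp : M.IsHyperplane (M.closure I) := by
    refine ⟨M.isFlat_closure I, ?_⟩
    rw [M.eRk_closure_eq, hcircuit.eRk_add_one_eq, encard_eq_eRank_iff hI, hcard]
  have hlarge := Set.ncard_le_ncard (M.subset_closure I hI)
    (M.ground_finite.subset (M.closure_subset_ground I))
  have := hsmall _ hhyp
  omega

theorem eq_sub_sum_numHyperplanes_of_isPaving {R : Type*} [Ring R] {Φ : Matroid α → R}
    {c φ : ℕ → ℕ → R}
    (hrelax : ∀ (M : Matroid α) [M.Finite] (H : Set α) (hH : M.IsStressedHyperplane H),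
      Φ (M.relax hH) = Φ M + φ M.natRank H.ncard)
    (hunif : ∀ (M : Matroid α) [M.Finite] (k : ℕ), IsUniform M k → Φ M = c k M.E.ncard)
    (hM : M.IsPaving) :
    Φ M = c M.natRank M.E.ncard -
      ∑ h ∈ Finset.Icc M.natRank M.E.ncard, (M.numHyperplanes h : R) * φ M.natRank h := by
  induction hm : ∑ h ∈ Finset.Icc M.natRank M.E.ncard, M.numHyperplanes h
    using Nat.strong_induction_on generalizing M with
  | _ m ih =>
    by_cases hsmall : ∀ H, M.IsHyperplane H → H.ncard < M.natRank
    · rw [hunif M _ (isUniform_of_isPaving hM hsmall), Finset.sum_eq_zero, sub_zero]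
      intro h hh
      have hnum : M.numHyperplanes h = 0 := by
        rw [numHyperplanes, Set.ncard_eq_zero (finite_setOf_isHyperplane M h),
          Set.eq_empty_iff_forall_notMem]
        rintro H ⟨hH, rfl⟩
        exact (hsmall H hH).not_ge (Finset.mem_Icc.1 hh).1
      rw [hnum, Nat.cast_zero, zero_mul]
    · push Not at hsmall
      obtain ⟨H, hH, hk⟩ := hsmall
      have hHs := isStressedHyperplane_of_isPaving hM hH
      have hcount := sum_numHyperplanes_relax hHs hk (1 : ℕ → ℕ)
      simp only [Nat.cast_id, Pi.one_apply, mul_one] at hcount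
      have hdecrease : ∑ h ∈ Finset.Icc (M.relax hHs).natRank M.E.ncard,
          (M.relax hHs).numHyperplanes h < m := by
        rw [natRank_relax]
        omega
      have hΦ := ih _ hdecrease (isPaving_relax hM hHs) rfl
      rw [hrelax, natRank_relax] at hΦ
      rw [sum_numHyperplanes_relax hHs hk, ← sub_sub]
      exact eq_sub_of_add_eq hΦ

theorem klPoly_of_isPaving (hM : M.IsPaving) :
    klPoly M = klPoly (uniform M.natRank M.E.ncard) - ∑ h ∈ Finset.Icc M.natRank M.E.ncard,
      (M.numHyperplanes h : ℤ[X]) * klIncrement M.natRank h :=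
  eq_sub_sum_numHyperplanes_of_isPaving (c := fun k n => klPoly (uniform k n))
    (fun _ _ _ hH => klPoly_relax hH) (fun _ _ _ hU => hU.klPoly_eq) hM

theorem invKLPoly_of_isPaving (hM : M.IsPaving) :
    invKLPoly M = invKLPoly (uniform M.natRank M.E.ncard) - ∑ h ∈ Finset.Icc M.natRank M.E.ncard,
      (M.numHyperplanes h : ℤ[X]) * invKLIncrement M.natRank h :=
  eq_sub_sum_numHyperplanes_of_isPaving (c := fun k n => invKLPoly (uniform k n))
    (fun _ _ _ hH => invKLPoly_relax hH) (fun _ _ _ hU => hU.invKLPoly_eq) hM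

theorem zPoly_of_isPaving (hM : M.IsPaving) :
    zPoly M = zPoly (uniform M.natRank M.E.ncard) - ∑ h ∈ Finset.Icc M.natRank M.E.ncard,
      (M.numHyperplanes h : ℤ[X]) * zIncrement M.natRank h :=
  eq_sub_sum_numHyperplanes_of_isPaving (c := fun k n => zPoly (uniform k n))
    (fun _ _ _ hH => zPoly_relax hH) (fun _ _ _ hU => hU.zPoly_eq) hM

end Paving

end KazhdanLusztig

theorem theorem1p3 :
    ∃ p q z : ℕ → ℕ → ℤ[X],
      (∀ k h : ℕ, 1 ≤ k → 1 ≤ h →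
        ∀ (α : Type u) (M : Matroid α) [M.Finite] (H : Set α) (hH : M.IsStressedHyperplane H),
          M.natRank = k → H.ncard = h →
          (M.relax hH).klPoly = M.klPoly + p k h ∧
          (M.relax hH).invKLPoly = M.invKLPoly + q k h ∧
          (M.relax hH).zPoly = M.zPoly + z k h) ∧
      (∀ k n : ℕ, ∀ (α : Type u) (M : Matroid α) [M.Finite],
          M.IsPaving → M.natRank = k → M.E.ncard = n →
          M.klPoly = (Matroid.uniform k n).klPoly
            - ∑ h ∈ Finset.Icc k n, (M.numHyperplanes h : ℤ[X]) * p k h ∧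
          M.invKLPoly = (Matroid.uniform k n).invKLPoly
            - ∑ h ∈ Finset.Icc k n, (M.numHyperplanes h : ℤ[X]) * q k h ∧
          M.zPoly = (Matroid.uniform k n).zPoly
            - ∑ h ∈ Finset.Icc k n, (M.numHyperplanes h : ℤ[X]) * z k h) := by
  refine ⟨KazhdanLusztig.klIncrement, KazhdanLusztig.invKLIncrement, KazhdanLusztig.zIncrement,
    ?_, ?_⟩
  · rintro k h - - α M _ H hH rfl rfl
    exact ⟨KazhdanLusztig.klPoly_relax hH, KazhdanLusztig.invKLPoly_relax hH,
      KazhdanLusztig.zPoly_relax hH⟩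
  · rintro k n α M _ hM rfl rfl
    exact ⟨KazhdanLusztig.klPoly_of_isPaving hM, KazhdanLusztig.invKLPoly_of_isPaving hM,
      KazhdanLusztig.zPoly_of_isPaving hM⟩
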